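/- Fix an integer $n\ge 1$, $p\in(0,\infty]$, a vector of positive weights $\mathbf w=(w_0,\dots,w_n)$, and integers $k,l\ge 0$ with $0<k+2l\le n$. For $q(z)=a_0+a_1z+\dots+a_nz^n$ put $l_{p,\mathbf w}[q]=\bigl(\sum_{i=0}^n|w_ia_i|^p\bigr)^{1/p}$ if $p<\infty$ and $l_{\infty,\mathbf w}[q]=\max_i w_i|a_i|$, and let $\mathbb B_{p,\mathbf w}^{n+1}\subset\mathbb R^{n+1}$ be the set of coefficient vectors with $l_{p,\mathbf w}\le 1$. Its volume is $$\mathrm{Vol}_{n+1}(\mathbb B_{p,\mathbf w}^{n+1})=\frac{2^{n+1}\,\Gamma(1+\frac1p)^{n+1}}{w_0w_1\cdots w_n\,\Gamma(1+\frac{n+1}p)}\qquad(\text{with } 1/\infty=0).$$ Call an integer polynomial prime if it is irreducible over $\mathbb Q$, primitive, and has positive leading coefficient. Let $\mathbb C_+=\{z\in\mathbb C:\operatorname{Im}z>0\}$. For a Borel set $B\subset\mathbb R^k\times\mathbb C_+^l$ and $Q>0$ let $\Phi_{p,\mathbf w,k,l}(Q,B)$ be the (finite) number of points $(x_1,\dots,x_k,z_1,\dots,z_l)\in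 B$ with pairwise distinct coordinates that are all roots of one prime polynomial $q$ of degree $n$ with $l_{p,\mathbf w}[q]\le Q$; that is, the number of ordered $(k,l)$-tuples in $B$ of distinct conjugate algebraic numbers of degree $n$ and weighted $l_p$-height at most $Q$. Then there exists an integrable function $\rho_{p,\mathbf w,k,l}:\mathbb R^k\times\mathbb C_+^l\to[0,\infty)$ such that for every Borel set $B\subset\mathbb R^k\times\mathbb C_+^l$ whose boundary has Lebesgue measure zero, $$\lim_{Q\to\infty}\frac{\Phi_{p,\mathbf w,k,l}(Q,B)}{Q^{n+1}}=\frac{\mathrm{Vol}_{n+1}(\mathbb B_{p,\mathbf w}^{n+1})}{2\,\zeta(n+1)}\int_B\rho_{p,\mathbf w,k,l}(\mathbf x,\mathbf z)\,d\mathbf x\,d\mathbf z .$$ -/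

import Mathlib

open MeasureTheory Filter Topology
open scoped ENNReal Polynomial

noncomputable section

namespace AlgHeight

/-- The `w`-weighted `l_p`-norm (a quasi-norm for `p < 1`) of a coefficient vector
`(a_0, …, a_n)`, for `p ∈ (0, ∞]`. -/
def lpw {n : ℕ} (p : ℝ≥0∞) (w a : Fin (n + 1) → ℝ) : ℝ :=
  if p = ∞ then ⨆ i, w i * |a i|
  else (∑ i, |w i * a i| ^ p.toReal) ^ (1 / p.toReal)

/-- The unit ball of the weighted `l_p`-norm in `ℝ^{n+1}`. -/
def unitBall {n : ℕ} (p : ℝ≥0∞) (w : Fin (n + 1) → ℝ) : Set (Fin (n + 1) → ℝ) :=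
  {a | lpw p w a ≤ 1}

/-- The `w`-weighted `l_p`-norm of an integer polynomial of degree at most `n`. -/
def polyHeight {n : ℕ} (p : ℝ≥0∞) (w : Fin (n + 1) → ℝ) (q : ℤ[X]) : ℝ :=
  lpw p w (fun i => (q.coeff i : ℝ))

/-- Prime polynomials: irreducible over `ℚ`, primitive, with positive leading coefficient.
These are exactly the minimal polynomials (over `ℤ`) of algebraic numbers. -/
def IsPrimePoly (q : ℤ[X]) : Prop :=
  Irreducible (q.map (Int.castRingHom ℚ)) ∧ q.IsPrimitive ∧ 0 < q.leadingCoeff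

/-- Prime polynomials of degree `n` and weighted `l_p`-norm at most `Q`. -/
def primePolys {n : ℕ} (p : ℝ≥0∞) (w : Fin (n + 1) → ℝ) (Q : ℝ) : Set ℤ[X] :=
  {q | q.natDegree = n ∧ polyHeight p w q ≤ Q ∧ IsPrimePoly q}

/-- The configuration space `ℝ^k × ℂ_+^l`, an open subset of `ℝ^k × ℂ^l`; `ℂ_+` is the open
upper half-plane. -/
def configSpace (k l : ℕ) : Set ((Fin k → ℝ) × (Fin l → ℂ)) :=
  {v | ∀ j, 0 < (v.2 j).im}

/-- The ordered tuples `(x, z) ∈ B` of distinct conjugate algebraic numbers of degree `n` and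
weighted `l_p`-norm at most `Q`, i.e. of distinct roots of one prime polynomial. For
`B ⊆ configSpace k l` the real coordinates are automatically different from the complex ones. -/
def conjTuples {n : ℕ} (p : ℝ≥0∞) (w : Fin (n + 1) → ℝ) (k l : ℕ) (Q : ℝ)
    (B : Set ((Fin k → ℝ) × (Fin l → ℂ))) : Set ((Fin k → ℝ) × (Fin l → ℂ)) :=
  {v | v ∈ B ∧ Function.Injective v.1 ∧ Function.Injective v.2 ∧
    ∃ q ∈ primePolys p w Q,
      (∀ i, Polynomial.aeval (v.1 i) q = 0) ∧ (∀ j, Polynomial.aeval (v.2 j) q = 0)}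

/-- The number of tuples in `conjTuples`. -/
def Phi {n : ℕ} (p : ℝ≥0∞) (w : Fin (n + 1) → ℝ) (k l : ℕ) (Q : ℝ)
    (B : Set ((Fin k → ℝ) × (Fin l → ℂ))) : ℕ :=
  (conjTuples p w k l Q B).ncard

end AlgHeight

end

/-! Put `m = n - k - 2l`. A tuple `v` of distinct roots of a prime `q` amounts to a real
factorization `q = factorPoly v * g` with `deg g ≤ m`, that is, to a point of the fibre over `q` of
the map `coeffMap : (v, g) ↦ coefficients of the product`. Source and target both have dimension `n
+ 1`. Hence the number of tuples in `B` is `fiberCount`, a bounded integer function of the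
coefficient vector that is unchanged by scaling (`encard_coeffMap_fiber_smul`).

Such a function is the sum over `j` of the indicators of its level sets `{count ≥ j}`. So the
problem is to count prime polynomials in dilates of `levelSet`, which is bounded, symmetric and
star-shaped. Lattice points give its volume, Möbius inversion a factor `1/ζ(n+1)`, and the choice of
sign a factor `1/2`; reducible polynomials are negligible because Mahler measure is multiplicative
(`tendsto_ncard_prime`).

This requires the level sets to have null boundary (`volume_frontier_levelSet`). Over exact degree
`n` the map `coeffMap` is proper, so by the inverse function theorem the count is locally constant
away from critical values and from images of boundary points of `B`. Both are null, the first by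
Sard's theorem.

Summing volumes over `j` gives the integral of the count over the unit ball. By the area formula
(`lintegral_encard_fiber`) this integral is a finite measure of `B`, absolutely continuous with
respect to Lebesgue measure; its normalized density is `ρ`.

The volume of the ball comes from evaluating the integral of `exp (-∑ |w i * x i| ^ p)` in two ways.
-/

noncomputable section

namespace AlgHeight

/-! ### Area formula and local constancy of fibre counts. -/

section AreaFormula

variable {F : Type*} [NormedAddCommGroup F] [NormedSpace ℝ F]

lemma isOpen_setOf_det_fderiv_ne_zero {f : F → F} (hf : ContDiff ℝ 1 f) :
    IsOpen {x | (fderiv ℝ f x).det ≠ 0} := by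
  have : Continuous fun x => (fderiv ℝ f x).det :=
    ContinuousLinearMap.continuous_det.comp (hf.continuous_fderiv (by simp))
  exact isOpen_ne_fun this continuous_const

variable [FiniteDimensional ℝ F]

lemma exists_hasStrictFDerivAt_equiv {f : F → F} (hf : ContDiff ℝ 1 f) {x : F}
    (hx : (fderiv ℝ f x).det ≠ 0) :
    ∃ e : F ≃L[ℝ] F, HasStrictFDerivAt f (e : F →L[ℝ] F) x := by
  refine ⟨(fderiv ℝ f x).toContinuousLinearEquivOfDetNeZero hx, ?_⟩
  have := (hf.contDiffAt (x := x)).hasStrictFDerivAt (by simp)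
  simpa using this

lemma exists_isOpen_injOn {f : F → F} (hf : ContDiff ℝ 1 f) {x : F}
    (hx : (fderiv ℝ f x).det ≠ 0) : ∃ U, IsOpen U ∧ x ∈ U ∧ Set.InjOn f U := by
  obtain ⟨e, he⟩ := exists_hasStrictFDerivAt_equiv hf hx
  have : CompleteSpace F := FiniteDimensional.complete ℝ F
  exact ⟨_, (he.toOpenPartialHomeomorph f).open_source, he.mem_toOpenPartialHomeomorph_source,
    (he.toOpenPartialHomeomorph f).injOn⟩

/-- The regular points of a `C¹` map are covered by countably many disjoint Borel sets on which
the map is injective. -/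
lemma exists_partition_injOn [MeasurableSpace F] [BorelSpace F] {f : F → F}
    (hf : ContDiff ℝ 1 f) :
    ∃ P : ℕ → Set F, (∀ i, MeasurableSet (P i)) ∧ (∀ i, Set.InjOn f (P i)) ∧
      Pairwise (Function.onFun Disjoint P) ∧ ⋃ i, P i = {x | (fderiv ℝ f x).det ≠ 0} := by
  set D := {x | (fderiv ℝ f x).det ≠ 0} with hD
  have hDo : IsOpen D := isOpen_setOf_det_fderiv_ne_zero hf
  have h : ∀ x, ∃ U, IsOpen U ∧ (x ∈ D → x ∈ U) ∧ Set.InjOn f U := by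
    intro x
    by_cases hx : x ∈ D
    · obtain ⟨U, h1, h2, h3⟩ := exists_isOpen_injOn hf hx
      exact ⟨U, h1, fun _ => h2, h3⟩
    · exact ⟨∅, isOpen_empty, fun h => absurd h hx, by simp⟩
  choose U hUo hUx hUi using h
  have : ProperSpace F := FiniteDimensional.proper ℝ F
  obtain ⟨t, htD, htc, hcov⟩ := TopologicalSpace.countable_cover_nhdsWithin (s := D) (f := U)
    fun x hx => mem_nhdsWithin_of_mem_nhds ((hUo x).mem_nhds (hUx x hx))
  rcases t.eq_empty_or_nonempty with rfl | hne
  · refine ⟨fun _ => ∅, by simp, by simp, fun i j _ => by simp [Function.onFun], ?_⟩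
    have : D = ∅ := by simpa using hcov
    simp [this]
  · obtain ⟨g, rfl⟩ := htc.exists_eq_range hne
    refine ⟨disjointed fun i => U (g i) ∩ D, ?_, ?_, disjoint_disjointed _, ?_⟩
    · exact fun i => MeasurableSet.disjointed
        (fun j => ((hUo _).inter hDo).measurableSet) i
    · exact fun i => (hUi (g i)).mono ((disjointed_subset _ i).trans Set.inter_subset_left)
    · rw [iUnion_disjointed, ← Set.iUnion_inter]
      refine Set.inter_eq_right.2 ?_
      simpa using hcov

/-- The area formula, with multiplicities, for `C¹` maps between spaces of equal dimension. -/
theorem lintegral_encard_fiber [MeasurableSpace F] [BorelSpace F] (μ : Measure F)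
    [μ.IsAddHaarMeasure] {f : F → F} (hf : ContDiff ℝ 1 f) {A T : Set F}
    (hA : MeasurableSet A) (hT : MeasurableSet T) :
    ∫⁻ a in T, ((A ∩ f ⁻¹' {a}).encard : ℝ≥0∞) ∂μ =
      ∫⁻ x in A ∩ f ⁻¹' T, ENNReal.ofReal |(fderiv ℝ f x).det| ∂μ := by
  obtain ⟨P, hPm, hPi, hPd, hPu⟩ := exists_partition_injOn hf
  have hd : ∀ s : Set F, ∀ x ∈ s, HasFDerivWithinAt f (fderiv ℝ f x) s x := fun s x _ =>
    ((hf.differentiable (by simp)) x).hasFDerivAt.hasFDerivWithinAt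
  have hsard : μ (f '' {x | (fderiv ℝ f x).det = 0}) = 0 :=
    addHaar_image_eq_zero_of_det_fderivWithin_eq_zero μ (hd _) fun x hx => hx
  have hfm : Measurable f := hf.continuous.measurable
  have himg : ∀ i, MeasurableSet (f '' (P i ∩ A)) := fun i =>
    measurable_image_of_fderivWithin ((hPm i).inter hA) (hd _)
      ((hPi i).mono Set.inter_subset_left)
  -- Off the critical values every preimage lies in exactly one piece, and each piece contains at
  -- most one, so the count is a sum of indicators of images.
  have h1 : ∀ᵐ a ∂μ, ((A ∩ f ⁻¹' {a}).encard : ℝ≥0∞) =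
      ∑' i, (f '' (P i ∩ A)).indicator 1 a := by
    filter_upwards [measure_eq_zero_iff_ae_notMem.1 hsard] with a ha
    have hsplit : A ∩ f ⁻¹' {a} = ⋃ i, (P i ∩ A ∩ f ⁻¹' {a}) := by
      simp_rw [← Set.iUnion_inter, hPu]
      ext x
      constructor
      · rintro ⟨hx, hxa⟩
        exact ⟨⟨fun h0 => ha ⟨x, h0, hxa⟩, hx⟩, hxa⟩
      · exact fun h => ⟨h.1.2, h.2⟩
    have hms : ∀ i, MeasurableSet (P i ∩ A ∩ f ⁻¹' {a}) := fun i =>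
      ((hPm i).inter hA).inter (hfm (measurableSet_singleton a))
    rw [hsplit, ← Measure.count_apply (MeasurableSet.iUnion hms), measure_iUnion _ hms]
    · refine tsum_congr fun i => ?_
      rw [Measure.count_apply (hms i)]
      by_cases hmem : a ∈ f '' (P i ∩ A)
      · obtain ⟨x, hx, rfl⟩ := hmem
        have : P i ∩ A ∩ f ⁻¹' {f x} = {x} := by
          ext y
          constructor
          · rintro ⟨hy, hyx⟩
            exact hPi i hy.1 hx.1 hyx
          · rintro rfl
            exact ⟨hx, rfl⟩
        rw [this, Set.indicator_of_mem (Set.mem_image_of_mem _ hx)]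
        simp
      · have : P i ∩ A ∩ f ⁻¹' {a} = ∅ := by
          ext y
          simp only [Set.mem_inter_iff, Set.mem_preimage, Set.mem_singleton_iff,
            Set.mem_empty_iff_false, iff_false]
          rintro ⟨hy, rfl⟩
          exact hmem ⟨y, hy, rfl⟩
        rw [this, Set.indicator_of_notMem hmem]
        simp
    · exact fun i j hij => ((hPd hij).mono (Set.inter_subset_left.trans Set.inter_subset_left)
        (Set.inter_subset_left.trans Set.inter_subset_left))
  rw [lintegral_congr_ae (ae_restrict_of_ae h1), lintegral_tsum
    (f := fun i a => (f '' (P i ∩ A)).indicator (1 : F → ℝ≥0∞) a) fun i =>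
    (measurable_one.indicator (himg i)).aemeasurable]
  have hmB : ∀ i, MeasurableSet (P i ∩ (A ∩ f ⁻¹' T)) := fun i =>
    (hPm i).inter (hA.inter (hfm hT))
  have h2 : ∀ i, ∫⁻ a in T, (f '' (P i ∩ A)).indicator 1 a ∂μ =
      ∫⁻ x in P i ∩ (A ∩ f ⁻¹' T), ENNReal.ofReal |(fderiv ℝ f x).det| ∂μ := by
    intro i
    rw [lintegral_indicator_one (himg i), Measure.restrict_apply (himg i),
      lintegral_abs_det_fderiv_eq_addHaar_image μ (hmB i) (hd _)
        ((hPi i).mono Set.inter_subset_left)]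
    congr 1
    ext a
    constructor
    · rintro ⟨⟨x, hx, rfl⟩, hT'⟩
      exact ⟨x, ⟨hx.1, hx.2, hT'⟩, rfl⟩
    · rintro ⟨x, hx, rfl⟩
      exact ⟨⟨x, ⟨hx.1, hx.2.1⟩, rfl⟩, hx.2.2⟩
  simp_rw [h2]
  rw [← lintegral_iUnion hmB fun i j hij =>
    (hPd hij).mono Set.inter_subset_left Set.inter_subset_left, ← Set.iUnion_inter, hPu]
  -- Critical points may be put back into the domain, since the integrand vanishes there.
  rw [← Measure.restrict_restrict (isOpen_setOf_det_fderiv_ne_zero hf).measurableSet,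
    setLIntegral_eq_of_support_subset]
  intro x hx h0
  simp [h0] at hx

/-- Over a regular value near which a `C¹` map is proper, the number of preimages in a set is
locally constant, provided that no preimage lies on the boundary of the set. -/
theorem eventually_encard_fiber_eq {f : F → F} (hf : ContDiff ℝ 1 f) {A K : Set F} {a : F}
    (hK : K ∈ 𝓝 a) (hfK : IsCompact (f ⁻¹' K)) (hdet : ∀ x, f x = a → (fderiv ℝ f x).det ≠ 0)
    (hA : ∀ x, f x = a → x ∉ frontier A) :
    ∀ᶠ b in 𝓝 a, (A ∩ f ⁻¹' {b}).encard = (A ∩ f ⁻¹' {a}).encard := by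
  set S := f ⁻¹' {a} with hS
  have hScl : IsClosed S := isClosed_singleton.preimage hf.continuous
  have hScomp : IsCompact S := hfK.of_isClosed_subset hScl
    (Set.preimage_mono (Set.singleton_subset_iff.2 (mem_of_mem_nhds hK)))
  have hloc : ∀ x ∈ S, ∃ U, IsOpen U ∧ x ∈ U ∧ Set.InjOn f U := fun x hx =>
    exists_isOpen_injOn hf (hdet x hx)
  -- The fibre is compact, and local injectivity makes it discrete.
  have hSfin : S.Finite := by
    choose! U hUo hUx hUi using hloc
    obtain ⟨t, htS, ht⟩ := hScomp.elim_nhds_subcover U fun x hx => (hUo x hx).mem_nhds (hUx x hx)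
    refine t.finite_toSet.subset fun y hy => ?_
    obtain ⟨x, hxt, hyU⟩ := Set.mem_iUnion₂.1 (ht hy)
    have : y = x := hUi x (htS x hxt) hyU (hUx x (htS x hxt))
      (by rw [show f y = a from hy, show f x = a from htS x hxt])
    rwa [this]
  obtain ⟨V, hV, hVd⟩ := hSfin.t2_separation
  have hW : ∀ x ∈ S, ∃ W, IsOpen W ∧ x ∈ W ∧ Set.InjOn f W ∧ W ⊆ V x ∧
      ∀ y ∈ W, (y ∈ A ↔ x ∈ A) := by
    intro x hx
    obtain ⟨U, hUo, hUx, hUi⟩ := hloc x hx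
    obtain ⟨W, hWo, hWx, hWA⟩ : ∃ W, IsOpen W ∧ x ∈ W ∧ ∀ y ∈ W, (y ∈ A ↔ x ∈ A) := by
      have hxA := hA x hx
      by_cases hxc : x ∈ closure A
      · have hxi : x ∈ interior A := by
          by_contra h
          exact hxA ⟨hxc, h⟩
        exact ⟨interior A, isOpen_interior, hxi, fun y hy =>
          iff_of_true (interior_subset hy) (interior_subset hxi)⟩
      · exact ⟨(closure A)ᶜ, isClosed_closure.isOpen_compl, hxc, fun y hy =>
          iff_of_false (fun h => hy (subset_closure h)) fun h => hxc (subset_closure h)⟩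
    exact ⟨U ∩ V x ∩ W, (hUo.inter (hV x).2).inter hWo, ⟨⟨hUx, (hV x).1⟩, hWx⟩,
      hUi.mono (Set.inter_subset_left.trans Set.inter_subset_left),
      Set.inter_subset_left.trans Set.inter_subset_right, fun y hy => hWA y hy.2⟩
  choose! W hWo hWx hWi hWV hWA using hW
  -- Openness of `f` at each preimage shows that none disappears; in `hfar`, compactness of `f ⁻¹'
  -- K` shows that no new one arrives from elsewhere.
  have hnear : ∀ᶠ b in 𝓝 a, ∀ x ∈ S, ∃ y ∈ W x, f y = b := by
    refine (hSfin.eventually_all).2 fun x hx => ?_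
    obtain ⟨e, he⟩ := exists_hasStrictFDerivAt_equiv hf (hdet x hx)
    have : CompleteSpace F := FiniteDimensional.complete ℝ F
    have h := he.map_nhds_eq_of_equiv
    rw [show f x = a from hx] at h
    rw [← h]
    exact mem_map.2 (Filter.mem_of_superset ((hWo x hx).mem_nhds (hWx x hx))
      fun y hy => ⟨y, hy, rfl⟩)
  have hfar : ∀ᶠ b in 𝓝 a, f ⁻¹' {b} ⊆ ⋃ x ∈ S, W x := by
    have hC : IsCompact (f ⁻¹' K \ ⋃ x ∈ S, W x) := hfK.diff (isOpen_biUnion hWo)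
    have hcl : IsClosed (f '' (f ⁻¹' K \ ⋃ x ∈ S, W x)) := (hC.image hf.continuous).isClosed
    have hna : a ∉ f '' (f ⁻¹' K \ ⋃ x ∈ S, W x) := by
      rintro ⟨x, hx, hxa⟩
      exact hx.2 (Set.mem_iUnion₂.2 ⟨x, hxa, hWx x hxa⟩)
    filter_upwards [hcl.isOpen_compl.mem_nhds hna, hK] with b hb hbK y hy
    by_contra hyn
    exact hb ⟨y, ⟨by rwa [Set.mem_preimage, show f y = b from hy], hyn⟩, hy⟩
  filter_upwards [hnear, hfar] with b hb hb'
  choose! g hgW hgb using hb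
  have hinj : Set.InjOn g (A ∩ S) := by
    intro x hx y hy hxy
    by_contra hne
    have := hVd hx.2 hy.2 hne
    exact Set.disjoint_left.1 this (hWV x hx.2 (hgW x hx.2)) (hxy ▸ hWV y hy.2 (hgW y hy.2))
  have himg : g '' (A ∩ S) = A ∩ f ⁻¹' {b} := by
    ext y
    constructor
    · rintro ⟨x, hx, rfl⟩
      exact ⟨(hWA x hx.2 _ (hgW x hx.2)).2 hx.1, hgb x hx.2⟩
    · rintro ⟨hyA, hyb⟩
      obtain ⟨x, hxS, hyW⟩ := Set.mem_iUnion₂.1 (hb' hyb)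
      refine ⟨x, ⟨(hWA x hxS y hyW).1 hyA, hxS⟩, ?_⟩
      exact hWi x hxS (hgW x hxS) hyW (by rw [hgb x hxS, show f y = b from hyb])
  rw [← himg, hinj.encard_image]

end AreaFormula

/-! ### Lattice points and coprime lattice points in dilates. -/

section LatticePoints

open scoped Pointwise

variable {ι : Type*}

/-- The integer vectors in the dilate `x • S`, for `x ≠ 0`. -/
def latticePoints (S : Set (ι → ℝ)) (x : ℝ) : Set (ι → ℤ) :=
  {a | x⁻¹ • (fun i => (a i : ℝ)) ∈ S}

lemma latticePoints_mono {S T : Set (ι → ℝ)} (h : S ⊆ T) (x : ℝ) :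
    latticePoints S x ⊆ latticePoints T x := fun _ ha => h ha

variable [Fintype ι]

lemma abs_le_of_mem_latticePoints {S : Set (ι → ℝ)} {R x : ℝ} (hR : ∀ s ∈ S, ‖s‖ ≤ R)
    (hx : 0 < x) {a : ι → ℤ} (ha : a ∈ latticePoints S x) (i : ι) : |(a i : ℝ)| ≤ x * R := by
  have h := (norm_le_pi_norm _ i).trans (hR _ ha)
  rw [Pi.smul_apply, norm_smul, norm_inv, Real.norm_of_nonneg hx.le, Real.norm_eq_abs] at h
  rwa [inv_mul_le_iff₀ hx] at h

lemma latticePoints_subset_Icc {S : Set (ι → ℝ)} {R x : ℝ} (hR : ∀ s ∈ S, ‖s‖ ≤ R)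
    (hx : 0 < x) :
    latticePoints S x ⊆ Set.Icc (fun _ => -⌊x * R⌋) (fun _ => ⌊x * R⌋) := by
  intro a ha
  have h := fun i => abs_le.1 (abs_le_of_mem_latticePoints hR hx ha i)
  refine ⟨fun i => ?_, fun i => Int.le_floor.2 (h i).2⟩
  have : -a i ≤ ⌊x * R⌋ := Int.le_floor.2 (by push_cast; linarith [(h i).1])
  linarith

lemma finite_latticePoints {S : Set (ι → ℝ)} (hS : Bornology.IsBounded S) {x : ℝ} (hx : 0 < x) :
    (latticePoints S x).Finite := by
  classical
  obtain ⟨R, hR⟩ := hS.exists_norm_le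
  exact (Set.finite_Icc _ _).subset (latticePoints_subset_Icc hR hx)

/-- Since `0 ∉ S`, any lattice point forces `1 ≤ x * R`, whence `2 * ⌊x * R⌋ + 1 ≤ 3 * R * x` and no
lower-order term is needed. This uniformity in `x > 0` lets the bound dominate the Möbius series. -/
lemma ncard_latticePoints_le {S : Set (ι → ℝ)} {R x : ℝ} (hR0 : 0 ≤ R) (hR : ∀ s ∈ S, ‖s‖ ≤ R)
    (h0 : (0 : ι → ℝ) ∉ S) (hx : 0 < x) :
    ((latticePoints S x).ncard : ℝ) ≤ (3 * R) ^ Fintype.card ι * x ^ Fintype.card ι := by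
  classical
  rcases (latticePoints S x).eq_empty_or_nonempty with he | ⟨a, ha⟩
  · rw [he, Set.ncard_empty, Nat.cast_zero]
    positivity
  · have hne : ∃ i, a i ≠ 0 := by
      by_contra! h
      apply h0
      have : x⁻¹ • (fun i => (a i : ℝ)) = 0 := by
        ext i
        simp [h i]
      rw [← this]
      exact ha
    obtain ⟨i, hi⟩ := hne
    have h1 : 1 ≤ x * R := le_trans (by exact_mod_cast Int.one_le_abs hi)
      (abs_le_of_mem_latticePoints hR hx ha i)
    have hfl : (0 : ℤ) ≤ ⌊x * R⌋ := Int.floor_nonneg.2 (by linarith)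
    have h2 : (latticePoints S x).ncard ≤
        (Set.Icc (fun _ : ι => -⌊x * R⌋) (fun _ => ⌊x * R⌋)).ncard :=
      Set.ncard_le_ncard (latticePoints_subset_Icc hR hx) (Set.finite_Icc _ _)
    have h3 : (Set.Icc (fun _ : ι => -⌊x * R⌋) (fun _ => ⌊x * R⌋)).ncard =
        (⌊x * R⌋ + 1 + ⌊x * R⌋).toNat ^ Fintype.card ι := by
      rw [← Finset.coe_Icc, Set.ncard_coe_finset, Pi.card_Icc]
      simp
    rw [h3] at h2
    calc ((latticePoints S x).ncard : ℝ)
        ≤ (((⌊x * R⌋ + 1 + ⌊x * R⌋).toNat : ℕ) : ℝ) ^ Fintype.card ι := by exact_mod_cast h2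
      _ ≤ (3 * R * x) ^ Fintype.card ι := by
        gcongr
        have : (((⌊x * R⌋ + 1 + ⌊x * R⌋).toNat : ℕ) : ℝ) = ⌊x * R⌋ + 1 + ⌊x * R⌋ := by
          have : (((⌊x * R⌋ + 1 + ⌊x * R⌋).toNat : ℕ) : ℤ) = ⌊x * R⌋ + 1 + ⌊x * R⌋ :=
            Int.toNat_of_nonneg (by linarith)
          exact_mod_cast this
        rw [this]
        have := Int.floor_le (x * R)
        nlinarith
      _ = _ := mul_pow _ _ _

lemma image_latticePoints (S : Set (ι → ℝ)) (x : ℝ) :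
    (fun a : ι → ℤ => x⁻¹ • (fun i => (a i : ℝ))) '' latticePoints S x =
      S ∩ ↑(x⁻¹ • Submodule.span ℤ (Set.range (Pi.basisFun ℝ ι))) := by
  have hmem : ∀ v : ι → ℝ, v ∈ Submodule.span ℤ (Set.range (Pi.basisFun ℝ ι)) ↔
      ∃ a : ι → ℤ, (fun i => (a i : ℝ)) = v := by
    intro v
    rw [Module.Basis.mem_span_iff_repr_mem]
    simp only [Pi.basisFun_repr, Set.mem_range, algebraMap_int_eq, eq_intCast]
    constructor
    · intro h
      choose a ha using h
      exact ⟨a, funext ha⟩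
    · rintro ⟨a, rfl⟩ i
      exact ⟨a i, rfl⟩
  ext v
  constructor
  · rintro ⟨a, ha, rfl⟩
    exact ⟨ha, Submodule.smul_mem_pointwise_smul _ _ _ ((hmem _).2 ⟨a, rfl⟩)⟩
  · rintro ⟨hv, hv'⟩
    obtain ⟨y, hy, rfl⟩ := (Set.mem_smul_set).1 hv'
    obtain ⟨a, rfl⟩ := (hmem y).1 hy
    exact ⟨a, hv, rfl⟩

lemma ncard_latticePoints (S : Set (ι → ℝ)) {x : ℝ} (hx : 0 < x) :
    (latticePoints S x).ncard =
      Nat.card ↑(S ∩ ↑(x⁻¹ • Submodule.span ℤ (Set.range (Pi.basisFun ℝ ι)))) := by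
  rw [← image_latticePoints S x, Nat.card_coe_set_eq, Set.ncard_image_of_injective]
  intro a b hab
  have h := smul_right_injective (ι → ℝ) (inv_ne_zero hx.ne') hab
  ext i
  exact_mod_cast congrFun h i

/-- Lattice points in the dilates of a bounded set with null boundary that is star-shaped about
the origin. -/
theorem tendsto_ncard_latticePoints {S : Set (ι → ℝ)} (hb : Bornology.IsBounded S)
    (hfr : volume (frontier S) = 0) (hst : ∀ t : ℝ, 0 < t → t ≤ 1 → t • S ⊆ S) :
    Tendsto (fun x : ℝ => ((latticePoints S x).ncard : ℝ) / x ^ Fintype.card ι) atTop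
      (𝓝 (volume.real S)) := by
  -- The set `S` itself need not be Borel. Its interior and closure are; they inherit the hypotheses
  -- and have the same volume, so they sandwich the count.
  have key : ∀ T : Set (ι → ℝ), Bornology.IsBounded T → MeasurableSet T →
      volume (frontier T) = 0 → (∀ t : ℝ, 0 < t → t ≤ 1 → t • T ⊆ T) →
      Tendsto (fun x : ℝ => ((latticePoints T x).ncard : ℝ) / x ^ Fintype.card ι) atTop
      (𝓝 (volume.real T)) := by
    intro T h1 h2 h3 h4
    refine (tendsto_card_div_pow_atTop_volume' T h1 h2 h3 ?_).congr' ?_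
    · intro x y hx hxy
      have hy := hx.trans_le hxy
      have : x • T = y • (x / y) • T := by
        rw [smul_smul, mul_div_cancel₀ _ hy.ne']
      rw [this]
      exact Set.smul_set_mono (h4 _ (div_pos hx hy) ((div_le_one hy).2 hxy))
    · filter_upwards [eventually_gt_atTop 0] with x hx
      rw [ncard_latticePoints T hx, Submodule.coe_pointwise_smul]
  have hi := key (interior S) (hb.subset interior_subset) isOpen_interior.measurableSet
    (measure_mono_null frontier_interior_subset hfr) fun t h0 h1 => by
      rw [← interior_smul₀ h0.ne']
      exact interior_mono (hst t h0 h1)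
  have hc := key (closure S) hb.closure isClosed_closure.measurableSet
    (measure_mono_null frontier_closure_subset hfr) fun t h0 h1 => by
      rw [← closure_smul₀ (c := t)]
      exact closure_mono (hst t h0 h1)
  have hic : volume (closure S) ≤ volume (interior S) := by
    rw [closure_eq_interior_union_frontier]
    exact (measure_union_le _ _).trans (by simp [hfr])
  have e1 : volume.real (interior S) = volume.real S := by
    rw [measureReal_def, measureReal_def, le_antisymm (measure_mono interior_subset)
      ((measure_mono subset_closure).trans hic)]
  have e2 : volume.real (closure S) = volume.real S := by
    rw [← e1, measureReal_def, measureReal_def, le_antisymm hic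
      (measure_mono (interior_subset.trans subset_closure))]
  rw [e1] at hi
  rw [e2] at hc
  refine tendsto_of_tendsto_of_tendsto_of_le_of_le' hi hc ?_ ?_
  · filter_upwards [eventually_gt_atTop 0] with x hx
    gcongr
    exacts [finite_latticePoints hb hx, latticePoints_mono interior_subset x]
  · filter_upwards [eventually_gt_atTop 0] with x hx
    gcongr
    exacts [finite_latticePoints hb.closure hx, latticePoints_mono subset_closure x]

/-- Coprime integer vectors. -/
def IsCoprimeVec (a : ι → ℤ) : Prop := ∀ d : ℕ, (∀ i, (d : ℤ) ∣ a i) → d = 1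

/-- The `d` dividing every entry are the divisors of the gcd, so this is `∑ μ(d)` over the divisors
of one integer. The cutoff `N` works because the gcd is at most `|a i₀|`. -/
lemma sum_moebius_dvd_vec {a : ι → ℤ} {i₀ : ι} (ha : a i₀ ≠ 0) {N : ℕ}
    (hN : (a i₀).natAbs ≤ N) [DecidablePred (IsCoprimeVec (ι := ι))] :
    ∑ d ∈ Finset.range (N + 1),
      (if ∀ i, (d : ℤ) ∣ a i then (ArithmeticFunction.moebius d : ℤ) else 0) =
      if IsCoprimeVec a then 1 else 0 := by
  set g : ℕ := (Finset.univ.gcd a).natAbs with hg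
  have hdvd : ∀ d : ℕ, (∀ i, (d : ℤ) ∣ a i) ↔ d ∣ g := by
    intro d
    rw [hg, ← Int.natCast_dvd, Finset.dvd_gcd_iff]
    simp
  have hg0 : g ≠ 0 := by
    intro h
    rw [hg, Int.natAbs_eq_zero, Finset.gcd_eq_zero_iff] at h
    exact ha (h i₀ (Finset.mem_univ _))
  have hgN : g ≤ N := by
    refine le_trans (Nat.le_of_dvd (Int.natAbs_pos.2 ha) ?_) hN
    rw [← Int.natCast_dvd]
    exact (hdvd g).2 dvd_rfl i₀
  have hcop : IsCoprimeVec a ↔ g = 1 := by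
    constructor
    · exact fun h => h g ((hdvd g).2 dvd_rfl)
    · intro h d hd
      rw [hdvd, h] at hd
      exact Nat.dvd_one.1 hd
  simp_rw [hdvd, hcop]
  rw [← Finset.sum_filter]
  have : (Finset.range (N + 1)).filter (fun d => d ∣ g) = g.divisors := by
    ext d
    simp only [Finset.mem_filter, Finset.mem_range, Nat.mem_divisors]
    refine ⟨fun h => ⟨h.2, hg0⟩, fun h => ⟨?_, h.1⟩⟩
    have := Nat.le_of_dvd (Nat.pos_of_ne_zero hg0) h.1
    omega
  rw [this, ← ArithmeticFunction.coe_mul_zeta_apply, ArithmeticFunction.moebius_mul_coe_zeta,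
    ArithmeticFunction.one_apply]

lemma tsum_moebius_div_pow {N : ℕ} (hN : 2 ≤ N) :
    ∑' d : ℕ, (ArithmeticFunction.moebius d : ℝ) / (d : ℝ) ^ N = ((riemannZeta N).re)⁻¹ := by
  have h1 : 1 < ((N : ℂ)).re := by simpa using by omega
  have hz := ArithmeticFunction.LSeries_zeta_mul_Lseries_moebius h1
  rw [ArithmeticFunction.LSeries_zeta_eq_riemannZeta h1] at hz
  have hζ : riemannZeta N = ((∑' d : ℕ, 1 / (d : ℝ) ^ N : ℝ) : ℂ) := by
    rw [zeta_nat_eq_tsum_of_gt_one (by omega)]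
    push_cast
    rfl
  have hμ : LSeries (fun n => ((ArithmeticFunction.moebius n : ℤ) : ℂ)) N =
      ((∑' d : ℕ, (ArithmeticFunction.moebius d : ℝ) / (d : ℝ) ^ N : ℝ) : ℂ) := by
    rw [LSeries, Complex.ofReal_tsum]
    refine tsum_congr fun d => ?_
    rcases eq_or_ne d 0 with rfl | hd
    · simp
    · rw [LSeries.term_of_ne_zero hd]
      simp
  rw [hζ, hμ] at hz
  rw [hζ, Complex.ofReal_re]
  exact eq_inv_of_mul_eq_one_right (by exact_mod_cast hz)

/-- Möbius inversion for the number of coprime integer vectors in a dilate of `S`. -/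
lemma ncard_coprime_latticePoints {S : Set (ι → ℝ)} (hb : Bornology.IsBounded S)
    (h0 : (0 : ι → ℝ) ∉ S) {x : ℝ} (hx : 0 < x) :
    ((latticePoints S x ∩ {a | IsCoprimeVec a}).ncard : ℝ) =
      ∑' d : ℕ, (ArithmeticFunction.moebius d : ℝ) * (latticePoints S (x / d)).ncard := by
  classical
  obtain ⟨R, hR⟩ := hb.exists_norm_le
  set T := (finite_latticePoints hb hx).toFinset with hT
  have hTm : ∀ a, a ∈ T ↔ a ∈ latticePoints S x := fun a => Set.Finite.mem_toFinset _
  set N := ⌊x * R⌋.toNat with hN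
  have hne : ∀ a ∈ T, ∃ i, a i ≠ 0 := by
    intro a ha
    by_contra! h
    apply h0
    have : x⁻¹ • (fun i => (a i : ℝ)) = 0 := by
      ext i
      simp [h i]
    rw [← this]
    exact (hTm a).1 ha
  have hle : ∀ a ∈ T, ∀ i, (a i).natAbs ≤ N := by
    intro a ha i
    have := latticePoints_subset_Icc hR hx ((hTm a).1 ha)
    have h1 := this.1 i
    have h2 := this.2 i
    simp only at h1 h2
    omega
  have hA : ∀ d : ℕ, d ≠ 0 → (latticePoints S (x / d)).ncard =
      (T.filter fun a => ∀ i, (d : ℤ) ∣ a i).card := by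
    intro d hd
    have hdR : (d : ℝ) ≠ 0 := by exact_mod_cast hd
    rw [← Set.ncard_coe_finset, ← Set.ncard_image_of_injective (latticePoints S (x / d))
      (f := fun a i => (d : ℤ) * a i)]
    · congr 1
      ext a
      simp only [Set.mem_image, Finset.coe_filter, Set.mem_ofPred_eq, hTm]
      have hsm : ∀ b : ι → ℤ, (x / d)⁻¹ • (fun i => (b i : ℝ)) =
          x⁻¹ • fun i => (((d : ℤ) * b i : ℤ) : ℝ) := by
        intro b
        ext i
        simp only [Pi.smul_apply, smul_eq_mul]
        push_cast
        rw [inv_div]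
        ring
      constructor
      · rintro ⟨b, hb, rfl⟩
        refine ⟨?_, fun i => dvd_mul_right _ _⟩
        have hb' : (x / d)⁻¹ • (fun i => (b i : ℝ)) ∈ S := hb
        rw [hsm] at hb'
        exact hb'
      · rintro ⟨ha, hda⟩
        choose b hb using hda
        obtain rfl : a = fun i => (d : ℤ) * b i := funext hb
        refine ⟨b, ?_, rfl⟩
        change (x / d)⁻¹ • (fun i => (b i : ℝ)) ∈ S
        rw [hsm]
        exact ha
    · intro a b hab
      ext i
      exact mul_left_cancel₀ (by exact_mod_cast hd) (congrFun hab i)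
  -- For `d > N` a multiple of `d` with entries at most `N` is zero, which `S` excludes.
  have hzero : ∀ d ∉ Finset.range (N + 1),
      (ArithmeticFunction.moebius d : ℝ) * (latticePoints S (x / d)).ncard = 0 := by
    intro d hd
    have hd' : N + 1 ≤ d := by simpa using hd
    rw [hA d (by omega), Finset.card_eq_zero.2, Nat.cast_zero, mul_zero]
    refine Finset.filter_eq_empty_iff.2 fun a ha h => ?_
    obtain ⟨i, hi⟩ := hne a ha
    have h1 := Nat.le_of_dvd (Int.natAbs_pos.2 hi) (Int.natCast_dvd.1 (h i))
    have h2 := hle a ha i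
    omega
  rw [tsum_eq_sum hzero]
  have hleft : latticePoints S x ∩ {a | IsCoprimeVec a} =
      ↑(T.filter fun a => IsCoprimeVec a) := by
    ext a
    simp [hTm]
  rw [hleft, Set.ncard_coe_finset]
  have hsum : (((T.filter fun a => IsCoprimeVec a).card : ℕ) : ℤ) =
      ∑ d ∈ Finset.range (N + 1), ArithmeticFunction.moebius d *
        (T.filter fun a => ∀ i, (d : ℤ) ∣ a i).card := by
    rw [Finset.card_filter]
    push_cast
    rw [Finset.sum_congr rfl fun a ha => (sum_moebius_dvd_vec (hne a ha).choose_spec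
      (hle a ha _)).symm, Finset.sum_comm]
    refine Finset.sum_congr rfl fun d _ => ?_
    rw [Finset.card_filter]
    push_cast
    rw [Finset.mul_sum]
    simp
  have hsum' : (((T.filter fun a => IsCoprimeVec a).card : ℕ) : ℝ) =
      ∑ d ∈ Finset.range (N + 1), (ArithmeticFunction.moebius d : ℝ) *
        (T.filter fun a => ∀ i, (d : ℤ) ∣ a i).card := by exact_mod_cast hsum
  rw [hsum']
  refine Finset.sum_congr rfl fun d _ => ?_
  -- At `d = 0` the dilate by `x / 0` is meaningless, but `μ(0) = 0` removes the term.
  rcases eq_or_ne d 0 with rfl | hd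
  · simp
  · rw [hA d hd]

/-- Coprime lattice points in the dilates of a bounded star-shaped set with null boundary. -/
theorem tendsto_ncard_coprime_latticePoints (hι : 2 ≤ Fintype.card ι) {S : Set (ι → ℝ)}
    (hb : Bornology.IsBounded S) (hfr : volume (frontier S) = 0)
    (hst : ∀ t : ℝ, 0 < t → t ≤ 1 → t • S ⊆ S) (h0 : (0 : ι → ℝ) ∉ S) :
    Tendsto (fun x : ℝ => ((latticePoints S x ∩ {a | IsCoprimeVec a}).ncard : ℝ) /
      x ^ Fintype.card ι) atTop (𝓝 (volume.real S / (riemannZeta (Fintype.card ι)).re)) := by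
  set N := Fintype.card ι with hN
  obtain ⟨R, hR0, hR⟩ := hb.exists_pos_norm_le
  have hlim := tendsto_ncard_latticePoints hb hfr hst
  -- Dominated convergence for series: each term tends to `μ(d) d^(-N) vol S`, with majorant `(3R)^N
  -- d^(-N)`, summable because `N ≥ 2`.
  have hmain : Tendsto (fun x : ℝ => ∑' d : ℕ, (ArithmeticFunction.moebius d : ℝ) / (d : ℝ) ^ N *
      ((latticePoints S (x / d)).ncard / (x / d) ^ N)) atTop
      (𝓝 (∑' d : ℕ, (ArithmeticFunction.moebius d : ℝ) / (d : ℝ) ^ N * volume.real S)) := by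
    refine tendsto_tsum_of_dominated_convergence
      (bound := fun d : ℕ => 1 / (d : ℝ) ^ N * (3 * R) ^ N) ?_ ?_ ?_
    · exact (Real.summable_one_div_nat_pow.2 (by omega)).mul_right _
    · intro d
      rcases eq_or_ne d 0 with rfl | hd
      · simp
      · exact (hlim.comp (tendsto_id.atTop_div_const (by positivity))).const_mul _
    · filter_upwards [eventually_gt_atTop 0] with x hx d
      rcases eq_or_ne d 0 with rfl | hd
      · simp
        positivity
      have hxd : 0 < x / d := by positivity
      rw [norm_mul, norm_div, norm_pow, RCLike.norm_natCast]
      gcongr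
      · rw [Real.norm_eq_abs]
        exact_mod_cast ArithmeticFunction.abs_moebius_le_one
      · rw [Real.norm_of_nonneg (by positivity), div_le_iff₀ (by positivity)]
        exact ncard_latticePoints_le hR0.le hR h0 hxd
  rw [tsum_mul_right, tsum_moebius_div_pow hι, inv_mul_eq_div] at hmain
  refine hmain.congr' ?_
  filter_upwards [eventually_gt_atTop 0] with x hx
  rw [ncard_coprime_latticePoints hb h0 hx, div_eq_mul_inv, ← tsum_mul_right]
  refine tsum_congr fun d => ?_
  rcases eq_or_ne d 0 with rfl | hd
  · simp
  · have : (d : ℝ) ≠ 0 := by exact_mod_cast hd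
    rw [div_pow]
    field_simp

end LatticePoints

/-! ### Polynomials and their coefficient vectors. -/

section VecPoly

variable {R : Type*} [Semiring R] {d : ℕ}

/-- The polynomial with a given vector of coefficients. -/
def vecPoly (a : Fin d → R) : R[X] := ∑ i : Fin d, Polynomial.monomial (i : ℕ) (a i)

/-- The vector of the first `d` coefficients of a polynomial. -/
def coeffVec (d : ℕ) (q : R[X]) : Fin d → R := fun i => q.coeff i

lemma coeff_vecPoly (a : Fin d → R) (j : ℕ) :
    (vecPoly a).coeff j = if h : j < d then a ⟨j, h⟩ else 0 := by
  simp only [vecPoly, Polynomial.finsetSum_coeff, Polynomial.coeff_monomial]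
  split_ifs with h
  · rw [Finset.sum_eq_single ⟨j, h⟩]
    · simp
    · rintro i - hi
      exact if_neg fun h' => hi (Fin.ext h')
    · simp
  · exact Finset.sum_eq_zero fun i _ => if_neg fun h' => h (by omega)

lemma coeff_vecPoly_of_lt (a : Fin d → R) {j : ℕ} (h : j < d) :
    (vecPoly a).coeff j = a ⟨j, h⟩ := by
  rw [coeff_vecPoly, dif_pos h]

lemma coeff_vecPoly_of_le (a : Fin d → R) {j : ℕ} (h : d ≤ j) : (vecPoly a).coeff j = 0 := by
  rw [coeff_vecPoly, dif_neg h.not_gt]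

@[simp] lemma coeffVec_vecPoly (a : Fin d → R) : coeffVec d (vecPoly a) = a :=
  funext fun i => coeff_vecPoly_of_lt a i.2

lemma vecPoly_coeffVec {q : R[X]} (h : ∀ j, d ≤ j → q.coeff j = 0) :
    vecPoly (coeffVec d q) = q := by
  ext j
  rcases lt_or_ge j d with hj | hj
  · exact coeff_vecPoly_of_lt _ hj
  · rw [coeff_vecPoly_of_le _ hj, h j hj]

lemma vecPoly_coeffVec_of_natDegree_lt {q : R[X]} (h : q.natDegree < d) :
    vecPoly (coeffVec d q) = q :=
  vecPoly_coeffVec fun _ hj => Polynomial.coeff_eq_zero_of_natDegree_lt (h.trans_le hj)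

lemma natDegree_vecPoly_le {m : ℕ} (a : Fin (m + 1) → R) : (vecPoly a).natDegree ≤ m :=
  Polynomial.natDegree_le_iff_coeff_eq_zero.2 fun _ hj => coeff_vecPoly_of_le a hj

lemma natDegree_vecPoly {m : ℕ} {a : Fin (m + 1) → R} (ha : a (Fin.last m) ≠ 0) :
    (vecPoly a).natDegree = m :=
  le_antisymm (natDegree_vecPoly_le a) (Polynomial.le_natDegree_of_ne_zero (by
    rwa [coeff_vecPoly_of_lt a (Nat.lt_succ_self m)]))

lemma vecPoly_injective : Function.Injective (vecPoly : (Fin d → R) → R[X]) := fun a b h => by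
  rw [← coeffVec_vecPoly a, h, coeffVec_vecPoly]

lemma map_vecPoly {S : Type*} [Semiring S] (f : R →+* S) (a : Fin d → R) :
    (vecPoly a).map f = vecPoly fun i => f (a i) := by
  ext j
  rw [Polynomial.coeff_map, coeff_vecPoly, coeff_vecPoly]
  split_ifs <;> simp

lemma vecPoly_smul {S : Type*} [CommSemiring S] (t : S) (a : Fin d → S) :
    vecPoly (t • a) = Polynomial.C t * vecPoly a := by
  ext j
  rw [Polynomial.coeff_C_mul, coeff_vecPoly, coeff_vecPoly]
  split_ifs <;> simp

end VecPoly

/-! ### Rarity of reducible integer polynomials. -/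

section Reducible

/-- The Mahler measure of an integer polynomial. -/
abbrev intMahler (q : ℤ[X]) : ℝ := (q.map (Int.castRingHom ℂ)).mahlerMeasure

lemma mahlerMeasure_vecPoly_le {m : ℕ} (a : Fin (m + 1) → ℂ) {H : ℝ} (hH : ∀ i, ‖a i‖ ≤ H) :
    (vecPoly a).mahlerMeasure ≤ (m + 1) * H := by
  refine (Polynomial.mahlerMeasure_le_sum_norm_coeff _).trans ?_
  rw [Polynomial.sum_over_range' _ (by simp) (m + 1) (Nat.lt_succ_of_le (natDegree_vecPoly_le a)),
    Finset.sum_range]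
  refine (Finset.sum_le_sum fun i _ => ?_).trans
    (by simp : ∑ i : Fin (m + 1), H ≤ (m + 1) * H)
  rw [coeff_vecPoly_of_lt a i.2]
  exact hH i

lemma norm_coeff_le_two_pow_mul_mahlerMeasure {m : ℕ} {p : ℂ[X]} (hp : p.natDegree ≤ m) (i : ℕ) :
    ‖p.coeff i‖ ≤ 2 ^ m * p.mahlerMeasure := by
  refine (Polynomial.norm_coeff_le_choose_mul_mahlerMeasure i p).trans ?_
  refine mul_le_mul_of_nonneg_right ?_ p.mahlerMeasure_nonneg
  calc ((p.natDegree.choose i : ℕ) : ℝ) ≤ ((2 ^ p.natDegree : ℕ) : ℝ) := by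
        exact_mod_cast Nat.choose_le_two_pow _ _
    _ ≤ 2 ^ m := by
        push_cast
        exact pow_le_pow_right₀ (by norm_num) hp

lemma summable_norm_intVec_rpow_of_mem {d : ℕ} {s : ℝ} (hs : (d : ℝ) < s)
    (L : Submodule ℤ (Fin d → ℝ)) [DiscreteTopology L] [IsZLattice ℝ L]
    (hmem : ∀ u : Fin d → ℤ, (fun i => (u i : ℝ)) ∈ L) :
    Summable fun u : Fin d → ℤ => ‖(fun i => (u i : ℝ) : Fin d → ℝ)‖ ^ (-s) := by
  have hr : Module.finrank ℤ L = d := by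
    rw [ZLattice.rank ℝ L, Module.finrank_fin_fun]
  have h := ZLattice.summable_norm_rpow L (-s) (by rw [hr]; linarith)
  have hinj : Function.Injective fun u : Fin d → ℤ => (⟨_, hmem u⟩ : L) := by
    intro u v huv
    ext i
    have : ((u i : ℤ) : ℝ) = v i := congrFun (congrArg Subtype.val huv) i
    exact_mod_cast this
  have h2 := h.comp_injective hinj
  refine h2.congr fun u => ?_
  rw [Function.comp_apply, Submodule.coe_norm]

lemma summable_norm_intVec_rpow {d : ℕ} {s : ℝ} (hs : (d : ℝ) < s) :
    Summable fun u : Fin d → ℤ => ‖(fun i => (u i : ℝ) : Fin d → ℝ)‖ ^ (-s) := by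
  refine summable_norm_intVec_rpow_of_mem hs
    (Submodule.span ℤ (Set.range (Pi.basisFun ℝ (Fin d)))) fun u => ?_
  rw [Module.Basis.mem_span_iff_repr_mem]
  intro i
  exact ⟨u i, by simp⟩

/-- Integer vectors of length `n + 1` whose polynomial is a nonzero product of two polynomials of
degree less than `n`. -/
def reducibleVecs (n : ℕ) : Set (Fin (n + 1) → ℤ) :=
  {a | a ≠ 0 ∧ ∃ g h : ℤ[X], g.natDegree < n ∧ h.natDegree < n ∧ vecPoly a = g * h}

/-- Coefficient norms are comparable with Mahler measure, which is multiplicative; hence `‖g‖ * ‖h‖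
≤ C * H`. Raising to the power `s` gives a weight at least 1 on each factorization, so the number of
reducible vectors is bounded by a convergent double sum (Rankin's trick). -/
lemma one_le_norm_rpow_mul {n : ℕ} {H : ℝ} {s : ℝ} (hs : 0 ≤ s) {a : Fin (n + 1) → ℤ}
    (ha0 : a ≠ 0) (haH : ∀ i, |(a i : ℝ)| ≤ H) {g h : ℤ[X]} (hg : g.natDegree < n)
    (hh : h.natDegree < n) (hgh : vecPoly a = g * h) :
    1 ≤ ((n + 1) * (2 ^ n) ^ 2 * H) ^ s *
      (‖(fun i : Fin n => (g.coeff i : ℝ))‖ ^ (-s) *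
        ‖(fun i : Fin n => (h.coeff i : ℝ))‖ ^ (-s)) := by
  have hgh0 : g * h ≠ 0 := by
    rw [← hgh]
    intro h0
    apply ha0
    apply vecPoly_injective
    rw [h0]
    simp [vecPoly]
  have key : ∀ q : ℤ[X], q ≠ 0 → q.natDegree < n →
      0 < ‖(fun i : Fin n => (q.coeff i : ℝ))‖ ∧
      ‖(fun i : Fin n => (q.coeff i : ℝ))‖ ≤ 2 ^ n * intMahler q := by
    intro q hq hqn
    constructor
    · rw [norm_pos_iff]
      intro h0
      apply hq
      rw [← vecPoly_coeffVec_of_natDegree_lt hqn]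
      have : coeffVec n q = 0 := by
        ext i
        have : ((q.coeff i : ℤ) : ℝ) = 0 := congrFun h0 i
        exact_mod_cast this
      rw [this]
      simp [vecPoly]
    · have hM : 0 ≤ intMahler q := Polynomial.mahlerMeasure_nonneg _
      refine (pi_norm_le_iff_of_nonneg (by positivity)).2 fun i => ?_
      have h1 : (q.map (Int.castRingHom ℂ)).natDegree ≤ n := by
        rw [Polynomial.natDegree_map_eq_of_injective (Int.castRingHom ℂ).injective_int]
        exact hqn.le
      have := norm_coeff_le_two_pow_mul_mahlerMeasure h1 i
      simpa [coeffVec] using this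
  obtain ⟨hg1, hg2⟩ := key g (left_ne_zero_of_mul hgh0) hg
  obtain ⟨hh1, hh2⟩ := key h (right_ne_zero_of_mul hgh0) hh
  have hM : intMahler g * intMahler h ≤ (n + 1) * H := by
    rw [intMahler, intMahler, ← Polynomial.mahlerMeasure_mul, ← Polynomial.map_mul, ← hgh,
      map_vecPoly]
    refine mahlerMeasure_vecPoly_le _ fun i => ?_
    simpa using haH i
  have hprod : ‖(fun i : Fin n => (g.coeff i : ℝ))‖ *
      ‖(fun i : Fin n => (h.coeff i : ℝ))‖ ≤ (n + 1) * (2 ^ n) ^ 2 * H := by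
    calc _ ≤ (2 ^ n * intMahler g) * (2 ^ n * intMahler h) :=
          mul_le_mul hg2 hh2 hh1.le (hg1.le.trans hg2)
      _ = (2 ^ n) ^ 2 * (intMahler g * intMahler h) := by ring
      _ ≤ (2 ^ n) ^ 2 * ((n + 1) * H) := by gcongr
      _ = _ := by ring
  have hpos := mul_pos hg1 hh1
  rw [← Real.mul_rpow hg1.le hh1.le, Real.rpow_neg hpos.le, ← div_eq_mul_inv,
    one_le_div (by positivity)]
  exact Real.rpow_le_rpow hpos.le hprod hs

/-- Reducible polynomials are rare. -/
theorem exists_ncard_reducible_le (n : ℕ) :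
    ∃ K : ℝ, ∀ H : ℝ, 0 ≤ H →
      ((reducibleVecs n ∩ {a | ∀ i, |(a i : ℝ)| ≤ H}).ncard : ℝ) ≤ K * H ^ ((n : ℝ) + 1 / 2) := by
  classical
  -- The exponent must exceed `n` for the sums over `ℤ^n` to converge, and stay below `n + 1` for
  -- the bound to be negligible.
  set s : ℝ := n + 1 / 2 with hs
  have hs0 : 0 ≤ s := by positivity
  have hsum := summable_norm_intVec_rpow (d := n) (s := s) (by rw [hs]; linarith)
  set φ : (Fin n → ℤ) → ℝ := fun u => ‖(fun i => (u i : ℝ) : Fin n → ℝ)‖ ^ (-s) with hφ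
  have hφ0 : ∀ u, 0 ≤ φ u := fun u => by positivity
  have hsum2 : Summable fun x : (Fin n → ℤ) × (Fin n → ℤ) => φ x.1 * φ x.2 :=
    hsum.mul_of_nonneg hsum hφ0 hφ0
  refine ⟨((n + 1) * (2 ^ n) ^ 2) ^ s * ∑' x : (Fin n → ℤ) × (Fin n → ℤ), φ x.1 * φ x.2,
    fun H hH => ?_⟩
  set A := reducibleVecs n ∩ {a | ∀ i, |(a i : ℝ)| ≤ H} with hA
  have hfin : A.Finite := by
    refine (Set.finite_Icc (fun _ => -⌊H⌋) (fun _ => ⌊H⌋)).subset fun a ha => ?_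
    have h := fun i => abs_le.1 (ha.2 i)
    refine ⟨fun i => ?_, fun i => Int.le_floor.2 (h i).2⟩
    have : -a i ≤ ⌊H⌋ := Int.le_floor.2 (by push_cast; linarith [(h i).1])
    simp only
    linarith
  have hex : ∀ a ∈ A, ∃ g h : ℤ[X], g.natDegree < n ∧ h.natDegree < n ∧ vecPoly a = g * h :=
    fun a ha => ha.1.2
  choose! g h hg hh hgh using hex
  set T := hfin.toFinset with hT
  have hTm : ∀ a, a ∈ T ↔ a ∈ A := fun a => hfin.mem_toFinset
  set F : (Fin (n + 1) → ℤ) → (Fin n → ℤ) × (Fin n → ℤ) :=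
    fun a => (coeffVec n (g a), coeffVec n (h a)) with hF
  have hinj : Set.InjOn F T := by
    intro a ha b hb hab
    have ha' := (hTm a).1 ha
    have hb' := (hTm b).1 hb
    apply vecPoly_injective
    rw [hgh a ha', hgh b hb', ← vecPoly_coeffVec_of_natDegree_lt (hg a ha'),
      ← vecPoly_coeffVec_of_natDegree_lt (hh a ha'), ← vecPoly_coeffVec_of_natDegree_lt (hg b hb'),
      ← vecPoly_coeffVec_of_natDegree_lt (hh b hb'), show coeffVec n (g a) = coeffVec n (g b) from
        congrArg Prod.fst hab, show coeffVec n (h a) = coeffVec n (h b) from congrArg Prod.snd hab]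
  have hcard : A.ncard = T.card := Set.ncard_eq_toFinset_card A hfin
  calc (A.ncard : ℝ) = ∑ a ∈ T, (1 : ℝ) := by simp [hcard]
    _ ≤ ∑ a ∈ T, ((n + 1) * (2 ^ n) ^ 2 * H) ^ s * (φ (F a).1 * φ (F a).2) :=
        Finset.sum_le_sum fun a ha => by
          have ha' := (hTm a).1 ha
          exact one_le_norm_rpow_mul hs0 ha'.1.1 ha'.2 (hg a ha') (hh a ha') (hgh a ha')
    _ = ((n + 1) * (2 ^ n) ^ 2 * H) ^ s * ∑ x ∈ T.image F, φ x.1 * φ x.2 := by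
        rw [← Finset.mul_sum, Finset.sum_image hinj]
    _ ≤ ((n + 1) * (2 ^ n) ^ 2 * H) ^ s *
          ∑' x : (Fin n → ℤ) × (Fin n → ℤ), φ x.1 * φ x.2 := by
        gcongr
        exact hsum2.sum_le_tsum _ fun x _ => mul_nonneg (hφ0 _) (hφ0 _)
    _ = _ := by
        rw [Real.mul_rpow (by positivity) hH]
        ring

theorem tendsto_ncard_reducible (n : ℕ) (R : ℝ) (hR : 0 ≤ R) :
    Tendsto (fun x : ℝ => ((reducibleVecs n ∩ {a | ∀ i, |(a i : ℝ)| ≤ x * R}).ncard : ℝ) /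
      x ^ (n + 1)) atTop (𝓝 0) := by
  obtain ⟨K, hK⟩ := exists_ncard_reducible_le n
  have h1 : Tendsto (fun x : ℝ => K * R ^ ((n : ℝ) + 1 / 2) * x ^ (-(1 / 2 : ℝ))) atTop (𝓝 0) := by
    simpa using (tendsto_rpow_neg_atTop (y := 1 / 2) (by norm_num)).const_mul
      (K * R ^ ((n : ℝ) + 1 / 2))
  refine squeeze_zero' ?_ ?_ h1
  · filter_upwards [eventually_gt_atTop 0] with x hx
    positivity
  filter_upwards [eventually_gt_atTop 0] with x hx
  rw [div_le_iff₀ (by positivity)]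
  refine (hK _ (by positivity)).trans (le_of_eq ?_)
  rw [Real.mul_rpow hx.le hR, mul_assoc, mul_assoc, ← Real.rpow_natCast x,
    ← Real.rpow_add hx, mul_comm (x ^ _)]
  congr 3
  push_cast
  ring

end Reducible

/-! ### Counting prime polynomials in dilates. -/

section PrimePolynomials

open scoped Pointwise

lemma isPrimitive_vecPoly_iff {m : ℕ} (a : Fin (m + 1) → ℤ) :
    (vecPoly a).IsPrimitive ↔ IsCoprimeVec a := by
  have hdvd : ∀ d : ℤ, Polynomial.C d ∣ vecPoly a ↔ ∀ i, d ∣ a i := by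
    intro d
    rw [Polynomial.C_dvd_iff_dvd_coeff]
    constructor
    · intro h i
      have := h i
      rwa [coeff_vecPoly_of_lt a i.2] at this
    · intro h j
      rw [coeff_vecPoly]
      split_ifs with hj
      · exact h _
      · exact dvd_zero _
  constructor
  · intro h d hd
    have := h d ((hdvd d).2 hd)
    exact Nat.isUnit_iff.1 (Int.ofNat_isUnit.1 this)
  · intro h d hd
    rw [Int.isUnit_iff_natAbs_eq]
    refine h _ fun i => ?_
    rw [Int.natAbs_dvd]
    exact (hdvd d).1 hd i

lemma leadingCoeff_vecPoly {m : ℕ} {R : Type*} [Semiring R] {a : Fin (m + 1) → R}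
    (ha : a (Fin.last m) ≠ 0) : (vecPoly a).leadingCoeff = a (Fin.last m) := by
  rw [Polynomial.leadingCoeff, natDegree_vecPoly ha, coeff_vecPoly_of_lt a (Nat.lt_succ_self m)]
  rfl

/-- A coprime vector with positive last entry gives a prime polynomial unless the polynomial
factors into polynomials of smaller degree. -/
lemma isPrimePoly_vecPoly {n : ℕ} (hn : n ≠ 0) {a : Fin (n + 1) → ℤ} (hc : IsCoprimeVec a)
    (hpos : 0 < a (Fin.last n)) (hred : a ∉ reducibleVecs n) : IsPrimePoly (vecPoly a) := by
  have hprim := (isPrimitive_vecPoly_iff a).2 hc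
  have hdeg := natDegree_vecPoly hpos.ne'
  refine ⟨?_, hprim, by rwa [leadingCoeff_vecPoly hpos.ne']⟩
  rw [← Polynomial.IsPrimitive.Int.irreducible_iff_irreducible_map_cast hprim]
  have hunit : ∀ g h : ℤ[X], vecPoly a = g * h → g.natDegree = 0 → IsUnit g := by
    intro g h hgh hg
    rw [Polynomial.eq_C_of_natDegree_eq_zero hg] at hgh ⊢
    exact Polynomial.isUnit_C.2 (hprim _ ⟨h, hgh⟩)
  have ha0 : a ≠ 0 := by
    rintro rfl
    exact hpos.ne' rfl
  have hv0 : vecPoly a ≠ 0 := fun h0 => hpos.ne' (by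
    rw [← leadingCoeff_vecPoly hpos.ne', h0, Polynomial.leadingCoeff_zero])
  refine irreducible_iff.2 ⟨fun hu => hn ?_, fun g h hgh => ?_⟩
  · rw [← hdeg, Polynomial.natDegree_eq_zero_of_isUnit hu]
  · by_contra! hcon
    have hg := mt (hunit g h hgh) hcon.1
    have hh := mt (hunit h g (by rw [hgh, mul_comm])) hcon.2
    have hgh0 : g * h ≠ 0 := hgh ▸ hv0
    have hsum : g.natDegree + h.natDegree = n := by
      rw [← Polynomial.natDegree_mul (left_ne_zero_of_mul hgh0) (right_ne_zero_of_mul hgh0),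
        ← hgh, hdeg]
    exact hred ⟨ha0, g, h, by omega, by omega, hgh⟩

/-- Prime polynomials of degree `n` with coefficient vectors in the dilates of `S`. -/
theorem tendsto_ncard_prime {n : ℕ} (hn : n ≠ 0) {S : Set (Fin (n + 1) → ℝ)}
    (hb : Bornology.IsBounded S) (hfr : volume (frontier S) = 0)
    (hst : ∀ t : ℝ, 0 < t → t ≤ 1 → t • S ⊆ S) (hneg : ∀ s ∈ S, -s ∈ S)
    (hlast : ∀ s ∈ S, s (Fin.last n) ≠ 0) :
    Tendsto (fun x : ℝ => (({q : ℤ[X] | q.natDegree = n ∧ IsPrimePoly q ∧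
      coeffVec (n + 1) q ∈ latticePoints S x}).ncard : ℝ) / x ^ (n + 1)) atTop
      (𝓝 (volume.real S / (2 * (riemannZeta ((n : ℂ) + 1)).re))) := by
  obtain ⟨R, hR0, hR⟩ := hb.exists_pos_norm_le
  have h0 : (0 : Fin (n + 1) → ℝ) ∉ S := fun h => hlast 0 h rfl
  have hcop := tendsto_ncard_coprime_latticePoints (by simpa using by omega) hb hfr hst h0
  rw [Fintype.card_fin] at hcop
  have hred := tendsto_ncard_reducible n R hR0.le
  set P : ℝ → Set (Fin (n + 1) → ℤ) := fun x =>
    latticePoints S x ∩ {a | IsCoprimeVec a} ∩ {a | 0 < a (Fin.last n)} with hP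
  set Pr : ℝ → Set (Fin (n + 1) → ℤ) := fun x =>
    latticePoints S x ∩ {a | IsPrimePoly (vecPoly a)} with hPr
  have hl : ∀ x, ∀ a ∈ latticePoints S x, a (Fin.last n) ≠ 0 := by
    intro x a ha h
    exact hlast _ ha (by simp [h])
  have hcard : ∀ x, ({q : ℤ[X] | q.natDegree = n ∧ IsPrimePoly q ∧
      coeffVec (n + 1) q ∈ latticePoints S x}).ncard = (Pr x).ncard := by
    intro x
    rw [← Set.ncard_image_of_injective (Pr x) vecPoly_injective]
    congr 1
    ext q
    constructor
    · rintro ⟨hq, hqp, hqS⟩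
      have := vecPoly_coeffVec_of_natDegree_lt (d := n + 1) (q := q) (by omega)
      refine ⟨coeffVec (n + 1) q, ⟨hqS, ?_⟩, this⟩
      change IsPrimePoly _
      rwa [this]
    · rintro ⟨a, ⟨haS, hap⟩, rfl⟩
      exact ⟨natDegree_vecPoly (hl x a haS), hap, by rwa [coeffVec_vecPoly]⟩
  simp_rw [hcard]
  have hfin : ∀ x, 0 < x → (latticePoints S x).Finite := fun x hx => finite_latticePoints hb hx
  -- The set is symmetric and last entries do not vanish, so exactly one of `a`, `-a` has positive
  -- last entry.
  have hhalf : ∀ x, 0 < x →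
      ((latticePoints S x ∩ {a | IsCoprimeVec a}).ncard : ℝ) = 2 * (P x).ncard := by
    intro x hx
    have hsplit : latticePoints S x ∩ {a | IsCoprimeVec a} =
        P x ∪ (fun a => -a) '' P x := by
      ext a
      have hnegS : ∀ b : Fin (n + 1) → ℤ, b ∈ latticePoints S x → -b ∈ latticePoints S x := by
        intro b hb
        have := hneg _ hb
        rw [← smul_neg] at this
        have h : (-fun i => (b i : ℝ)) = fun i => (((-b) i : ℤ) : ℝ) := by
          ext i
          simp
        rwa [h] at this
      have hnegC : ∀ b : Fin (n + 1) → ℤ, IsCoprimeVec b → IsCoprimeVec (-b) := by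
        intro b hb d hd
        exact hb d fun i => by simpa using hd i
      constructor
      · rintro ⟨h1, h2⟩
        rcases lt_or_gt_of_ne (hl x a h1) with h | h
        · exact Or.inr ⟨-a, ⟨⟨hnegS a h1, hnegC a h2⟩, by simpa using h⟩, neg_neg a⟩
        · exact Or.inl ⟨⟨h1, h2⟩, h⟩
      · rintro (h | ⟨b, hb, rfl⟩)
        · exact h.1
        · exact ⟨hnegS b hb.1.1, hnegC b hb.1.2⟩
    have hfP : (P x).Finite :=
      (hfin x hx).subset (Set.inter_subset_left.trans Set.inter_subset_left)
    rw [hsplit, Set.ncard_union_eq ?_ hfP (hfP.image _),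
      Set.ncard_image_of_injective _ neg_injective]
    · push_cast
      ring
    · rw [Set.disjoint_left]
      rintro a ha ⟨b, hb, rfl⟩
      have h1 : 0 < b (Fin.last n) := hb.2
      have h2 : 0 < -b (Fin.last n) := ha.2
      linarith
  have hPlim : Tendsto (fun x => ((P x).ncard : ℝ) / x ^ (n + 1)) atTop
      (𝓝 (volume.real S / (2 * (riemannZeta ((n : ℂ) + 1)).re))) := by
    have := hcop.div_const 2
    rw [div_div, mul_comm _ (2 : ℝ)] at this
    push_cast at this
    refine this.congr' ?_
    filter_upwards [eventually_gt_atTop 0] with x hx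
    rw [hhalf x hx]
    ring
  -- `P x` contains `Pr x` and exceeds it only by reducible vectors, so the two counts have the same
  -- limit.
  have hlow := hPlim.sub hred
  rw [sub_zero] at hlow
  refine tendsto_of_tendsto_of_tendsto_of_le_of_le' hlow hPlim ?_ ?_
  · filter_upwards [eventually_gt_atTop 0] with x hx
    rw [← sub_div]
    gcongr
    rw [sub_le_iff_le_add]
    have hsub : P x ⊆ Pr x ∪ (reducibleVecs n ∩ {a | ∀ i, |(a i : ℝ)| ≤ x * R}) := by
      rintro a ⟨⟨h1, h2⟩, h3⟩
      by_cases hr : a ∈ reducibleVecs n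
      · exact Or.inr ⟨hr, abs_le_of_mem_latticePoints hR hx h1⟩
      · exact Or.inl ⟨h1, isPrimePoly_vecPoly hn h2 h3 hr⟩
    have hf1 : (Pr x).Finite := (hfin x hx).subset Set.inter_subset_left
    have hf2 : (reducibleVecs n ∩ {a | ∀ i, |(a i : ℝ)| ≤ x * R}).Finite := by
      refine (finite_latticePoints (S := {s : Fin (n + 1) → ℝ | ‖s‖ ≤ R}) ?_ hx).subset ?_
      · exact isBounded_iff_forall_norm_le.2 ⟨R, fun s hs => hs⟩
      · rintro a ⟨-, ha⟩
        change ‖x⁻¹ • _‖ ≤ R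
        rw [norm_smul, norm_inv, Real.norm_of_nonneg hx.le, inv_mul_le_iff₀ hx]
        exact (pi_norm_le_iff_of_nonneg (by positivity)).2 ha
    exact_mod_cast (Set.ncard_le_ncard hsub (hf1.union hf2)).trans (Set.ncard_union_le _ _)
  · filter_upwards [eventually_gt_atTop 0] with x hx
    gcongr
    · exact (hfin x hx).subset (Set.inter_subset_left.trans Set.inter_subset_left)
    · rintro a ⟨h1, h2⟩
      refine ⟨⟨h1, (isPrimitive_vecPoly_iff a).1 h2.2.1⟩, ?_⟩
      have := h2.2.2
      rwa [leadingCoeff_vecPoly (hl x a h1)] at this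

end PrimePolynomials

/-! ### The multiplication map: smoothness, properness, fibres. -/

section CoefficientMap

open scoped ComplexConjugate

variable {k l m n : ℕ}

/-- The monic real polynomial with roots `x_i`, `z_j` and `conj z_j`. -/
def factorPoly (v : (Fin k → ℝ) × (Fin l → ℂ)) : ℝ[X] :=
  (∏ i, (Polynomial.X - Polynomial.C (v.1 i))) *
    ∏ j, (Polynomial.X ^ 2 - Polynomial.C (2 * (v.2 j).re) * Polynomial.X +
      Polynomial.C ((v.2 j).re ^ 2 + (v.2 j).im ^ 2))

/-- The roots of `factorPoly v`. -/
def rootFun (v : (Fin k → ℝ) × (Fin l → ℂ)) : Fin k ⊕ (Fin l ⊕ Fin l) → ℂ :=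
  Sum.elim (fun i => (v.1 i : ℂ)) (Sum.elim v.2 fun j => conj (v.2 j))

lemma map_factorPoly (v : (Fin k → ℝ) × (Fin l → ℂ)) :
    (factorPoly v).map Complex.ofRealHom =
      ∏ s, (Polynomial.X - Polynomial.C (rootFun v s)) := by
  rw [Fintype.prod_sum_type, Fintype.prod_sum_type, ← Finset.prod_mul_distrib]
  simp only [factorPoly, Polynomial.map_mul, Polynomial.map_prod, rootFun, Sum.elim_inl,
    Sum.elim_inr]
  congr 1
  · simp
  · refine Finset.prod_congr rfl fun j _ => ?_
    set z := v.2 j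
    have h1 : ((2 * z.re : ℝ) : ℂ) = z + conj z := by
      rw [Complex.add_conj]
    have h2 : ((z.re ^ 2 + z.im ^ 2 : ℝ) : ℂ) = z * conj z := by
      rw [Complex.mul_conj, Complex.normSq_apply, sq, sq]
    simp only [Polynomial.map_add, Polynomial.map_sub, Polynomial.map_pow, Polynomial.map_mul,
      Polynomial.map_X, Polynomial.map_C, Complex.ofRealHom_eq_coe, h1, h2]
    simp only [Polynomial.C_add, Polynomial.C_mul]
    ring

lemma monic_map_factorPoly (v : (Fin k → ℝ) × (Fin l → ℂ)) :
    ((factorPoly v).map Complex.ofRealHom).Monic := by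
  rw [map_factorPoly]
  exact Polynomial.monic_prod_X_sub_C _ _

lemma monic_factorPoly (v : (Fin k → ℝ) × (Fin l → ℂ)) : (factorPoly v).Monic :=
  Polynomial.monic_of_injective Complex.ofRealHom.injective (monic_map_factorPoly v)

lemma natDegree_factorPoly (v : (Fin k → ℝ) × (Fin l → ℂ)) :
    (factorPoly v).natDegree = k + 2 * l := by
  rw [← Polynomial.natDegree_map_eq_of_injective Complex.ofRealHom.injective, map_factorPoly,
    Polynomial.natDegree_finsetProd_X_sub_C_eq_card]
  simp
  ring

/-- The coefficient vector of `factorPoly v * (b_0 + ⋯ + b_m X ^ m)`. -/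
def coeffMap (n : ℕ) (y : ((Fin k → ℝ) × (Fin l → ℂ)) × (Fin (m + 1) → ℝ)) : Fin (n + 1) → ℝ :=
  coeffVec (n + 1) (factorPoly y.1 * vecPoly y.2)

lemma vecPoly_coeffMap (hn : k + 2 * l + m = n)
    (y : ((Fin k → ℝ) × (Fin l → ℂ)) × (Fin (m + 1) → ℝ)) :
    vecPoly (coeffMap n y) = factorPoly y.1 * vecPoly y.2 := by
  refine vecPoly_coeffVec_of_natDegree_lt (Nat.lt_succ_of_le ?_)
  refine Polynomial.natDegree_mul_le.trans ?_
  rw [natDegree_factorPoly, ← hn]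
  have := natDegree_vecPoly_le y.2
  omega

/-- The first factor is monic, so the leading coefficient of the product is carried by the second.
-/
lemma coeffMap_last (hn : k + 2 * l + m = n)
    (y : ((Fin k → ℝ) × (Fin l → ℂ)) × (Fin (m + 1) → ℝ)) :
    coeffMap n y (Fin.last n) = y.2 (Fin.last m) := by
  change (factorPoly y.1 * vecPoly y.2).coeff n = _
  rw [← hn, ← natDegree_factorPoly y.1,
    Polynomial.coeff_mul_add_eq_of_natDegree_le le_rfl (natDegree_vecPoly_le y.2),
    (monic_factorPoly y.1).coeff_natDegree, one_mul, coeff_vecPoly_of_lt _ (Nat.lt_succ_self m)]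
  rfl

lemma coeffMap_eq_iff (hn : k + 2 * l + m = n) {a : Fin (n + 1) → ℝ}
    {y : ((Fin k → ℝ) × (Fin l → ℂ)) × (Fin (m + 1) → ℝ)} :
    coeffMap n y = a ↔ factorPoly y.1 * vecPoly y.2 = vecPoly a := by
  rw [← vecPoly_coeffMap hn, vecPoly_injective.eq_iff]

lemma coeffMap_smul (t : ℝ) (y : ((Fin k → ℝ) × (Fin l → ℂ)) × (Fin (m + 1) → ℝ)) :
    coeffMap n (y.1, t • y.2) = t • coeffMap n y := by
  ext i
  simp only [coeffMap, coeffVec, vecPoly_smul, Pi.smul_apply, smul_eq_mul]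
  rw [mul_left_comm, Polynomial.coeff_C_mul]

section Smooth

variable {E : Type*} [NormedAddCommGroup E] [NormedSpace ℝ E]

lemma contDiff_coeff_mul {p q : E → ℝ[X]} (hp : ∀ j, ContDiff ℝ 1 fun y => (p y).coeff j)
    (hq : ∀ j, ContDiff ℝ 1 fun y => (q y).coeff j) (j : ℕ) :
    ContDiff ℝ 1 fun y => (p y * q y).coeff j := by
  simp_rw [Polynomial.coeff_mul]
  exact ContDiff.sum fun i _ => (hp _).mul (hq _)

lemma contDiff_coeff_prod {ι : Type*} (s : Finset ι) {p : ι → E → ℝ[X]}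
    (hp : ∀ i j, ContDiff ℝ 1 fun y => (p i y).coeff j) (j : ℕ) :
    ContDiff ℝ 1 fun y => (∏ i ∈ s, p i y).coeff j := by
  classical
  induction s using Finset.induction_on generalizing j with
  | empty => simpa using contDiff_const
  | insert i s hi ih =>
    simp_rw [Finset.prod_insert hi]
    exact contDiff_coeff_mul (hp i) ih j

lemma contDiff_coeff_factorPoly (j : ℕ) :
    ContDiff ℝ 1 fun v : (Fin k → ℝ) × (Fin l → ℂ) => (factorPoly v).coeff j := by
  refine contDiff_coeff_mul (fun j => contDiff_coeff_prod _ (fun i j => ?_) j)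
    (fun j => contDiff_coeff_prod _ (fun i j => ?_) j) j
  · simp only [Polynomial.coeff_sub, Polynomial.coeff_C]
    split_ifs <;> fun_prop
  · have hre : ContDiff ℝ 1 fun v : (Fin k → ℝ) × (Fin l → ℂ) => (v.2 i).re :=
      Complex.reCLM.contDiff.comp (by fun_prop)
    have him : ContDiff ℝ 1 fun v : (Fin k → ℝ) × (Fin l → ℂ) => (v.2 i).im :=
      Complex.imCLM.contDiff.comp (by fun_prop)
    simp only [Polynomial.coeff_add, Polynomial.coeff_sub, Polynomial.coeff_C,
      Polynomial.coeff_C_mul]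
    split_ifs <;> fun_prop

lemma contDiff_coeff_vecPoly {d : ℕ} (j : ℕ) :
    ContDiff ℝ 1 fun b : Fin d → ℝ => (vecPoly b).coeff j := by
  simp_rw [coeff_vecPoly]
  split_ifs <;> fun_prop

lemma contDiff_coeffMap :
    ContDiff ℝ 1 (coeffMap n : ((Fin k → ℝ) × (Fin l → ℂ)) × (Fin (m + 1) → ℝ) → _) := by
  rw [contDiff_pi]
  intro i
  have h1 (j : ℕ) : ContDiff ℝ 1 fun y : ((Fin k → ℝ) × (Fin l → ℂ)) × (Fin (m + 1) → ℝ) =>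
      (factorPoly y.1).coeff j := (contDiff_coeff_factorPoly j).comp contDiff_fst
  have h2 (j : ℕ) : ContDiff ℝ 1 fun y : ((Fin k → ℝ) × (Fin l → ℂ)) × (Fin (m + 1) → ℝ) =>
      (vecPoly y.2).coeff j := (contDiff_coeff_vecPoly j).comp contDiff_snd
  exact contDiff_coeff_mul h1 h2 i

end Smooth

lemma mahlerMeasure_monic_mul_ge {p q : ℂ[X]} (hp : p.Monic) :
    q.mahlerMeasure ≤ (p * q).mahlerMeasure := by
  rw [Polynomial.mahlerMeasure_mul]
  exact le_mul_of_one_le_left q.mahlerMeasure_nonneg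
    (Polynomial.one_le_mahlerMeasure_of_one_le_norm_leadingCoeff (by simp [hp.leadingCoeff]))

/-- The factor `X - z` has Mahler measure at least `‖z‖`, and its monic cofactor at least 1. -/
lemma norm_root_le_mahlerMeasure {p : ℂ[X]} (hp : p.Monic) {z : ℂ} (hz : p.IsRoot z) :
    ‖z‖ ≤ p.mahlerMeasure := by
  obtain ⟨q, rfl⟩ := Polynomial.dvd_iff_isRoot.2 hz
  have hq : q.Monic := (Polynomial.monic_X_sub_C z).of_mul_monic_left hp
  calc ‖z‖ ≤ (Polynomial.X - Polynomial.C z).mahlerMeasure := by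
        rw [Polynomial.mahlerMeasure_X_sub_C]
        exact le_max_right _ _
    _ ≤ _ := by
        rw [mul_comm]
        exact mahlerMeasure_monic_mul_ge hq

/-- `coeffMap` is proper over the polynomials of exact degree `n`. -/
lemma isCompact_preimage_coeffMap (hn : k + 2 * l + m = n) {δ R : ℝ} (hδ : 0 < δ) :
    IsCompact ((coeffMap n : ((Fin k → ℝ) × (Fin l → ℂ)) × (Fin (m + 1) → ℝ) → _) ⁻¹'
      {a | ‖a‖ ≤ R ∧ δ ≤ |a (Fin.last n)|}) := by
  refine Metric.isCompact_of_isClosed_isBounded ?_ ?_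
  · refine IsClosed.preimage contDiff_coeffMap.continuous ?_
    exact (isClosed_le continuous_norm continuous_const).inter
      (isClosed_le continuous_const (continuous_apply _).abs)
  · set M := (n + 1) * R with hM
    refine isBounded_iff_forall_norm_le.2 ⟨max (M / δ) (2 ^ m * M), ?_⟩
    rintro y ⟨hyR, hyδ⟩
    have hR : 0 ≤ R := (norm_nonneg _).trans hyR
    set p := (factorPoly y.1).map Complex.ofRealHom with hp
    set q := (vecPoly y.2).map Complex.ofRealHom with hq
    have hpm : p.Monic := monic_map_factorPoly y.1
    have hpq : (p * q).mahlerMeasure ≤ M := by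
      rw [hp, hq, ← Polynomial.map_mul, ← vecPoly_coeffMap hn, map_vecPoly]
      refine mahlerMeasure_vecPoly_le _ fun i => ?_
      simpa using (norm_le_pi_norm _ i).trans hyR
    -- The product of the two Mahler measures is at most `M`. The first is at least 1 and the second
    -- at least `δ`, so each is bounded; this bounds the roots of `p` and the coefficients of `q`.
    have hqM : q.mahlerMeasure ≤ M := (mahlerMeasure_monic_mul_ge hpm).trans hpq
    have hqδ : δ ≤ q.mahlerMeasure := by
      rw [coeffMap_last hn] at hyδ
      have hlast : y.2 (Fin.last m) ≠ 0 := by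
        intro h
        rw [h, abs_zero] at hyδ
        linarith
      refine le_trans ?_ q.leadingCoeff_le_mahlerMeasure
      rw [hq, Polynomial.leadingCoeff_map_of_injective Complex.ofRealHom.injective,
        leadingCoeff_vecPoly hlast]
      simpa using hyδ
    have hpM : p.mahlerMeasure ≤ M / δ := by
      rw [le_div_iff₀ hδ]
      rw [Polynomial.mahlerMeasure_mul] at hpq
      exact (mul_le_mul_of_nonneg_left hqδ p.mahlerMeasure_nonneg).trans hpq
    have hroot : ∀ s, ‖rootFun y.1 s‖ ≤ M / δ := by
      intro s
      refine (norm_root_le_mahlerMeasure hpm ?_).trans hpM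
      rw [hp, map_factorPoly, Polynomial.IsRoot, Polynomial.eval_prod]
      exact Finset.prod_eq_zero (Finset.mem_univ s) (by simp)
    have hMδ : 0 ≤ M / δ := p.mahlerMeasure_nonneg.trans hpM
    have hM0 : 0 ≤ M := by positivity
    refine max_le_max (max_le ?_ ?_) ?_
    · refine (pi_norm_le_iff_of_nonneg hMδ).2 fun i => ?_
      simpa [rootFun] using hroot (Sum.inl i)
    · exact (pi_norm_le_iff_of_nonneg hMδ).2 fun j => hroot (Sum.inr (Sum.inl j))
    · refine (pi_norm_le_iff_of_nonneg (by positivity)).2 fun i => ?_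
      have h1 : q.natDegree ≤ m := Polynomial.natDegree_map_le.trans (natDegree_vecPoly_le _)
      have h2 := norm_coeff_le_two_pow_mul_mahlerMeasure h1 i
      rw [hq, Polynomial.coeff_map, coeff_vecPoly_of_lt _ i.2] at h2
      refine le_trans (by simpa using h2) (mul_le_mul_of_nonneg_left hqM (by positivity))

lemma injOn_fst_coeffMap_fiber (hn : k + 2 * l + m = n) (a : Fin (n + 1) → ℝ) :
    Set.InjOn Prod.fst ((coeffMap n :
      ((Fin k → ℝ) × (Fin l → ℂ)) × (Fin (m + 1) → ℝ) → _) ⁻¹' {a}) := by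
  rintro ⟨v, b⟩ h1 ⟨v', b'⟩ h2 (rfl : v = v')
  have h1' := (coeffMap_eq_iff hn).1 h1
  have h2' := (coeffMap_eq_iff hn).1 h2
  simp only at h1' h2'
  rw [← h2'] at h1'
  rw [vecPoly_injective (mul_left_cancel₀ (monic_factorPoly v).ne_zero h1')]

lemma isRoot_of_coeffMap_eq (hn : k + 2 * l + m = n) {a : Fin (n + 1) → ℝ}
    {y : ((Fin k → ℝ) × (Fin l → ℂ)) × (Fin (m + 1) → ℝ)} (hy : coeffMap n y = a)
    (s : Fin k ⊕ (Fin l ⊕ Fin l)) :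
    ((vecPoly a).map Complex.ofRealHom).IsRoot (rootFun y.1 s) := by
  rw [← (coeffMap_eq_iff hn).1 hy, Polynomial.map_mul, map_factorPoly, Polynomial.IsRoot,
    Polynomial.eval_mul, Polynomial.eval_prod,
    Finset.prod_eq_zero (Finset.mem_univ s) (by simp), zero_mul]

/-- A point of the fibre is determined by its tuple `v`, whose `k + l` coordinates are among the at
most `n` roots of the polynomial. -/
lemma encard_coeffMap_fiber_le (hn : k + 2 * l + m = n) {a : Fin (n + 1) → ℝ}
    (ha : a (Fin.last n) ≠ 0)
    (A : Set (((Fin k → ℝ) × (Fin l → ℂ)) × (Fin (m + 1) → ℝ))) :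
    (A ∩ coeffMap n ⁻¹' {a}).encard ≤ ((n ^ k * n ^ l : ℕ) : ℕ∞) := by
  classical
  set Q := (vecPoly a).map Complex.ofRealHom with hQ
  have hdeg : Q.natDegree = n := by
    rw [hQ, Polynomial.natDegree_map_eq_of_injective Complex.ofRealHom.injective,
      natDegree_vecPoly ha]
  have hQ0 : Q ≠ 0 := by
    rw [hQ, Polynomial.map_ne_zero_iff Complex.ofRealHom.injective]
    intro h
    apply ha
    rw [← leadingCoeff_vecPoly ha, h, Polynomial.leadingCoeff_zero]
  set Z := Q.roots.toFinset with hZ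
  have hZn : Z.card ≤ n := by
    rw [← hdeg]
    exact (Multiset.toFinset_card_le _).trans (Polynomial.card_roots' _)
  set T : Finset ((Fin k → ℂ) × (Fin l → ℂ)) :=
    (Fintype.piFinset fun _ => Z) ×ˢ (Fintype.piFinset fun _ => Z) with hT
  set G : ((Fin k → ℝ) × (Fin l → ℂ)) × (Fin (m + 1) → ℝ) → (Fin k → ℂ) × (Fin l → ℂ) :=
    fun y => (fun i => (y.1.1 i : ℂ), y.1.2) with hG
  have hinj : Set.InjOn G (A ∩ coeffMap n ⁻¹' {a}) := by
    intro y hy y' hy' h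
    simp only [hG, Prod.mk.injEq] at h
    obtain ⟨h1, h2⟩ := h
    refine injOn_fst_coeffMap_fiber hn a hy.2 hy'.2 (Prod.ext ?_ h2)
    ext i
    exact Complex.ofReal_injective (congrFun h1 i)
  rw [← hinj.encard_image]
  have hsub : G '' (A ∩ coeffMap n ⁻¹' {a}) ⊆ T := by
    rintro _ ⟨y, hy, rfl⟩
    have hr : ∀ s, rootFun y.1 s ∈ Z := fun s => by
      rw [hZ, Multiset.mem_toFinset, Polynomial.mem_roots hQ0]
      exact isRoot_of_coeffMap_eq hn hy.2 s
    simp only [hT, Finset.mem_coe, Finset.mem_product, Fintype.mem_piFinset]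
    exact ⟨fun i => hr (Sum.inl i), fun j => hr (Sum.inr (Sum.inl j))⟩
  refine (Set.encard_le_encard hsub).trans ?_
  rw [Set.encard_coe_eq_coe_finsetCard, hT, Finset.card_product, Fintype.card_piFinset_const,
    Fintype.card_piFinset_const]
  exact_mod_cast Nat.mul_le_mul (Nat.pow_le_pow_left hZn k) (Nat.pow_le_pow_left hZn l)

/-- Scaling can be absorbed in the second factor, leaving the roots and hence membership in `B`
untouched. -/
lemma encard_coeffMap_fiber_smul (B : Set ((Fin k → ℝ) × (Fin l → ℂ))) (a : Fin (n + 1) → ℝ)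
    {t : ℝ} (ht : t ≠ 0) :
    ((Prod.fst ⁻¹' B : Set (_ × (Fin (m + 1) → ℝ))) ∩ coeffMap n ⁻¹' {t • a}).encard =
      ((Prod.fst ⁻¹' B : Set (_ × (Fin (m + 1) → ℝ))) ∩ coeffMap n ⁻¹' {a}).encard := by
  set φ : ((Fin k → ℝ) × (Fin l → ℂ)) × (Fin (m + 1) → ℝ) → _ := fun y => (y.1, t • y.2) with hφ
  have hinj : Function.Injective φ := by
    intro y y' h
    simp only [hφ, Prod.mk.injEq] at h
    obtain ⟨h1, h2⟩ := h
    exact Prod.ext h1 (smul_right_injective _ ht h2)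
  rw [← hinj.encard_image (_ ∩ coeffMap n ⁻¹' {a})]
  congr 1
  ext y
  constructor
  · rintro ⟨h1, h2⟩
    refine ⟨(y.1, t⁻¹ • y.2), ⟨h1, ?_⟩, ?_⟩
    · rw [Set.mem_preimage, coeffMap_smul, show coeffMap n y = t • a from h2, smul_smul,
        inv_mul_cancel₀ ht, one_smul]
      rfl
    · simp [hφ, smul_smul, mul_inv_cancel₀ ht]
  · rintro ⟨y, ⟨h1, h2⟩, rfl⟩
    refine ⟨h1, ?_⟩
    rw [Set.mem_preimage, coeffMap_smul, show coeffMap n y = a from h2]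
    rfl

/-- The three blocks of `rootFun` have zero, positive and negative imaginary part, so coincidences
occur only within a block. -/
lemma injective_rootFun_iff {v : (Fin k → ℝ) × (Fin l → ℂ)} (hv : v ∈ configSpace k l) :
    Function.Injective (rootFun v) ↔ Function.Injective v.1 ∧ Function.Injective v.2 := by
  constructor
  · intro h
    refine ⟨fun i i' hii => ?_, fun j j' hjj => ?_⟩
    · exact Sum.inl_injective (h (by simp [rootFun, hii]))
    · exact Sum.inl_injective (Sum.inr_injective (h (by simp [rootFun, hjj])))
  · rintro ⟨h1, h2⟩
    have him : ∀ j, 0 < (v.2 j).im := hv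
    rintro (i | j | j) (i' | j' | j') h <;>
      simp only [rootFun, Sum.elim_inl, Sum.elim_inr] at h
    · rw [h1 (Complex.ofReal_injective h)]
    · have := congrArg Complex.im h
      have := him j'
      simp at *
      linarith
    · have := congrArg Complex.im h
      have := him j'
      simp at *
      linarith
    · have := congrArg Complex.im h
      have := him j
      simp at *
      linarith
    · rw [h2 h]
    · have := congrArg Complex.im h
      have := him j
      have := him j'
      simp at *
      linarith
    · have := congrArg Complex.im h
      have := him j
      simp at *
      linarith
    · have := congrArg Complex.im h
      have := him j
      have := him j'
      simp at *
      linarith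
    · rw [h2 ((starRingEnd ℂ).injective h)]

/-- For a prime polynomial `q`, the tuples of distinct roots of `q` in `B` correspond to the
factorizations of `q` with first factor indexed by `B`. -/
lemma image_fst_coeffMap_fiber (hn : k + 2 * l + m = n)
    {B : Set ((Fin k → ℝ) × (Fin l → ℂ))} (hB : B ⊆ configSpace k l) {q : ℤ[X]}
    (hq : IsPrimePoly q) (hqn : q.natDegree = n) :
    Prod.fst '' ((Prod.fst ⁻¹' B : Set (_ × (Fin (m + 1) → ℝ))) ∩
        coeffMap n ⁻¹' {coeffVec (n + 1) (q.map (Int.castRingHom ℝ))}) =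
      {v | v ∈ B ∧ Function.Injective v.1 ∧ Function.Injective v.2 ∧
        (∀ i, Polynomial.aeval (v.1 i) q = 0) ∧ (∀ j, Polynomial.aeval (v.2 j) q = 0)} := by
  have hQ : vecPoly (coeffVec (n + 1) (q.map (Int.castRingHom ℝ))) = q.map (Int.castRingHom ℝ) := by
    refine vecPoly_coeffVec_of_natDegree_lt ?_
    rw [Polynomial.natDegree_map_eq_of_injective (Int.castRingHom ℝ).injective_int]
    omega
  have hQC : (vecPoly (coeffVec (n + 1) (q.map (Int.castRingHom ℝ)))).map Complex.ofRealHom =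
      q.map (Int.castRingHom ℂ) := by
    rw [hQ, Polynomial.map_map, RingHom.ext_int (Complex.ofRealHom.comp _) (Int.castRingHom ℂ)]
  have hsep : (q.map (Int.castRingHom ℂ)).Separable := by
    have := hq.1.separable.map (f := algebraMap ℚ ℂ)
    rwa [Polynomial.map_map, RingHom.ext_int ((algebraMap ℚ ℂ).comp _) (Int.castRingHom ℂ)] at this
  have haeval : ∀ z : ℂ, Polynomial.aeval z q = 0 ↔ (q.map (Int.castRingHom ℂ)).IsRoot z := by
    intro z
    rw [Polynomial.IsRoot, Polynomial.eval_map, Polynomial.aeval_def]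
    rfl
  have haevalR : ∀ x : ℝ, Polynomial.aeval x q = 0 ↔ Polynomial.aeval (x : ℂ) q = 0 := by
    intro x
    rw [show (x : ℂ) = algebraMap ℝ ℂ x from rfl, Polynomial.aeval_algebraMap_apply]
    simp
  ext v
  constructor
  · rintro ⟨y, ⟨hyB, hya⟩, rfl⟩
    have hyC : y.1 ∈ configSpace k l := hB hyB
    have hroot := fun s => isRoot_of_coeffMap_eq hn hya s
    rw [hQC] at hroot
    -- Irreducibility over `ℚ` makes `q` separable over `ℂ`, so the roots in any factorization are
    -- automatically distinct.
    have hinj : Function.Injective (rootFun y.1) := by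
      rw [← Polynomial.separable_prod_X_sub_C_iff, ← map_factorPoly]
      refine hsep.of_dvd ?_
      rw [← hQC, ← (coeffMap_eq_iff hn).1 hya, Polynomial.map_mul]
      exact dvd_mul_right _ _
    obtain ⟨h1, h2⟩ := (injective_rootFun_iff hyC).1 hinj
    exact ⟨hyB, h1, h2, fun i => (haevalR _).2 ((haeval _).2 (hroot (Sum.inl i))),
      fun j => (haeval _).2 (hroot (Sum.inr (Sum.inl j)))⟩
  · rintro ⟨hvB, h1, h2, h3, h4⟩
    have hinj := (injective_rootFun_iff (hB hvB)).2 ⟨h1, h2⟩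
    have hroot : ∀ s, (q.map (Int.castRingHom ℂ)).IsRoot (rootFun v s) := by
      rintro (i | j | j)
      · exact (haeval _).1 ((haevalR _).1 (h3 i))
      · exact (haeval _).1 (h4 j)
      · refine (haeval _).1 ?_
        have h := congrArg (starRingEnd ℂ) (h4 j)
        rw [map_zero] at h
        rw [← h]
        change _ = Complex.conjAe.toAlgHom.restrictScalars ℤ _
        rw [← Polynomial.aeval_algHom_apply]
        rfl
    -- Distinct roots give pairwise coprime linear divisors over `ℂ`; divisibility by their product
    -- descends to `ℝ`.
    have hdvd : factorPoly v ∣ vecPoly (coeffVec (n + 1) (q.map (Int.castRingHom ℝ))) := by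
      rw [← Polynomial.map_dvd_map' Complex.ofRealHom, hQC, map_factorPoly]
      exact Fintype.prod_dvd_of_coprime (Polynomial.pairwise_coprime_X_sub_C hinj)
        fun s => Polynomial.dvd_iff_isRoot.2 (hroot s)
    obtain ⟨g, hg⟩ := hdvd
    have hgm : g.natDegree ≤ m := by
      rcases eq_or_ne g 0 with rfl | hg0
      · simp
      have h := congrArg Polynomial.natDegree hg
      rw [Polynomial.natDegree_mul (monic_factorPoly v).ne_zero hg0, natDegree_factorPoly] at h
      have := natDegree_vecPoly_le (coeffVec (n + 1) (q.map (Int.castRingHom ℝ)))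
      omega
    refine ⟨(v, coeffVec (m + 1) g), ⟨hvB, (coeffMap_eq_iff hn).2 ?_⟩, rfl⟩
    rw [vecPoly_coeffVec_of_natDegree_lt (Nat.lt_succ_of_le hgm)]
    exact hg.symm

end CoefficientMap

/-! ### The weighted unit ball: boundary and volume. -/

section Ball

variable {n : ℕ} {p : ℝ≥0∞} {w : Fin (n + 1) → ℝ}

lemma lpw_top (w a : Fin (n + 1) → ℝ) : lpw ∞ w a = ⨆ i, w i * |a i| := if_pos rfl

lemma lpw_of_ne_top (hp : p ≠ ∞) (w a : Fin (n + 1) → ℝ) :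
    lpw p w a = (∑ i, |w i * a i| ^ p.toReal) ^ (1 / p.toReal) := if_neg hp

lemma lpw_smul (hp : 0 < p) (t : ℝ) (a : Fin (n + 1) → ℝ) :
    lpw p w (t • a) = |t| * lpw p w a := by
  by_cases h : p = ∞
  · subst h
    rw [lpw_top, lpw_top, Real.mul_iSup_of_nonneg (abs_nonneg t)]
    refine iSup_congr fun i => ?_
    rw [Pi.smul_apply, smul_eq_mul, abs_mul]
    ring
  · have hr : 0 < p.toReal := ENNReal.toReal_pos hp.ne' h
    rw [lpw_of_ne_top h, lpw_of_ne_top h]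
    have : ∀ i, |w i * (t • a) i| ^ p.toReal = |t| ^ p.toReal * |w i * a i| ^ p.toReal := by
      intro i
      rw [← Real.mul_rpow (abs_nonneg _) (abs_nonneg _), ← abs_mul, Pi.smul_apply, smul_eq_mul]
      ring_nf
    simp_rw [this]
    rw [← Finset.mul_sum, Real.mul_rpow (by positivity)
      (Finset.sum_nonneg fun i _ => by positivity), ← Real.rpow_mul (abs_nonneg _),
      mul_one_div_cancel hr.ne', Real.rpow_one]

lemma continuous_lpw (hp : 0 < p) : Continuous (lpw p w) := by
  by_cases h : p = ∞
  · subst h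
    have : lpw ∞ w = fun a => Finset.univ.sup' Finset.univ_nonempty fun i => w i * |a i| := by
      ext a
      rw [lpw_top, Finset.sup'_univ_eq_ciSup]
    rw [this]
    exact Continuous.finset_sup'_apply _ fun i _ => by fun_prop
  · have hr : 0 < p.toReal := ENNReal.toReal_pos hp.ne' h
    have : lpw p w = fun a => (∑ i, |w i * a i| ^ p.toReal) ^ (1 / p.toReal) :=
      funext (lpw_of_ne_top h w)
    rw [this]
    refine Continuous.rpow_const (continuous_finsetSum _ fun i _ =>
      Continuous.rpow_const (by fun_prop) fun _ => Or.inr hr.le) fun _ => Or.inr (by positivity)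

lemma mul_abs_le_lpw (hp : 0 < p) (hw : ∀ i, 0 < w i) (a : Fin (n + 1) → ℝ)
    (i : Fin (n + 1)) : w i * |a i| ≤ lpw p w a := by
  by_cases h : p = ∞
  · subst h
    rw [lpw_top]
    exact le_ciSup (f := fun i => w i * |a i|) (Set.finite_range _).bddAbove i
  · have hr : 0 < p.toReal := ENNReal.toReal_pos hp.ne' h
    rw [lpw_of_ne_top h]
    have h1 : |w i * a i| ^ p.toReal ≤ ∑ i, |w i * a i| ^ p.toReal :=
      Finset.single_le_sum (f := fun i => |w i * a i| ^ p.toReal)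
        (fun i _ => by positivity) (Finset.mem_univ i)
    have h2 := Real.rpow_le_rpow (by positivity) h1 (by positivity : 0 ≤ 1 / p.toReal)
    rw [← Real.rpow_mul (abs_nonneg _), mul_one_div_cancel hr.ne', Real.rpow_one, abs_mul,
      abs_of_pos (hw i)] at h2
    exact h2

lemma isBounded_unitBall (hp : 0 < p) (hw : ∀ i, 0 < w i) :
    Bornology.IsBounded (unitBall p w) := by
  have h : ∀ i, ∀ a ∈ unitBall p w, |a i| ≤ (w i)⁻¹ := fun i a ha => by
    rw [← mul_one (w i)⁻¹, le_inv_mul_iff₀ (hw i)]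
    exact (mul_abs_le_lpw hp hw a i).trans ha
  refine isBounded_iff_forall_norm_le.2 ⟨∑ i, (w i)⁻¹, fun a ha => ?_⟩
  have hpos : ∀ i, 0 ≤ (w i)⁻¹ := fun i => (inv_pos.2 (hw i)).le
  refine (pi_norm_le_iff_of_nonneg (Finset.sum_nonneg fun i _ => hpos i)).2 fun i => ?_
  exact (h i a ha).trans (Finset.single_le_sum (f := fun i => (w i)⁻¹)
    (fun i _ => hpos i) (Finset.mem_univ i))

lemma isClosed_unitBall (hp : 0 < p) : IsClosed (unitBall p w) :=
  isClosed_le (continuous_lpw hp) continuous_const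

/-- The level set of a continuous positively homogeneous function is null if its sublevel sets
have finite measure. -/
lemma volume_homogeneous_eq_one {g : (Fin (n + 1) → ℝ) → ℝ} (hg : Continuous g)
    (hom : ∀ t : ℝ, 0 < t → ∀ x, g (t • x) = t * g x) (hfin : volume {x | g x ≤ 1} ≠ ∞) :
    volume {x | g x = 1} = 0 := by
  set V := volume {x | g x ≤ 1} with hV
  have hscale : ∀ t : ℝ, 0 < t → volume {x | g x ≤ t} = ENNReal.ofReal (t ^ (n + 1)) * V := by
    intro t ht
    have : {x | g x ≤ t} = (fun x => t⁻¹ • x) ⁻¹' {x | g x ≤ 1} := by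
      ext x
      change g x ≤ t ↔ g (t⁻¹ • x) ≤ 1
      rw [hom _ (inv_pos.2 ht), inv_mul_le_iff₀ ht, mul_one]
    rw [this, Measure.addHaar_preimage_smul _ (inv_ne_zero ht.ne')]
    simp [abs_of_pos ht, hV]
  -- The level set is disjoint from `{g ≤ t}`, whose volume tends to `V` as `t` increases to 1; no
  -- volume remains for it.
  have hle : ∀ t : ℝ, 0 < t → t < 1 →
      volume {x | g x = 1} + ENNReal.ofReal (t ^ (n + 1)) * V ≤ V := by
    intro t ht ht1
    rw [← hscale t ht, ← measure_union]
    · refine measure_mono ?_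
      rintro x (hx | hx)
      · exact le_of_eq hx
      · exact le_trans (show g x ≤ t from hx) ht1.le
    · rw [Set.disjoint_left]
      intro x hx hx'
      have h1 : g x = 1 := hx
      have h2 : g x ≤ t := hx'
      linarith
    · exact (isClosed_le hg continuous_const).measurableSet
  have hlim : Tendsto (fun t : ℝ => volume {x | g x = 1} + ENNReal.ofReal (t ^ (n + 1)) * V)
      (𝓝[<] 1) (𝓝 (volume {x | g x = 1} + ENNReal.ofReal (1 ^ (n + 1)) * V)) := by
    refine Tendsto.const_add _ (ENNReal.Tendsto.mul_const ?_ (Or.inr hfin))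
    refine (ENNReal.continuous_ofReal.comp (continuous_pow (n + 1))).continuousAt.tendsto.mono_left
      nhdsWithin_le_nhds
  have h := le_of_tendsto hlim (b := V) (by
    filter_upwards [Ioo_mem_nhdsLT (show (0 : ℝ) < 1 by norm_num)] with t ht
    exact hle t ht.1 ht.2)
  rw [one_pow, ENNReal.ofReal_one, one_mul] at h
  by_contra hne
  exact absurd h (not_le.2 (by
    rw [add_comm]
    exact ENNReal.lt_add_right hfin hne))

lemma volume_frontier_unitBall (hp : 0 < p) (hw : ∀ i, 0 < w i) :
    volume (frontier (unitBall p w)) = 0 := by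
  have h := volume_homogeneous_eq_one (continuous_lpw (w := w) hp)
    (fun t ht x => by rw [lpw_smul hp, abs_of_pos ht])
    (isBounded_unitBall hp hw).measure_lt_top.ne
  exact measure_mono_null (frontier_le_subset_eq (continuous_lpw hp) continuous_const) h

lemma lintegral_Ici_exp_neg (c : ℝ) :
    ∫⁻ t in Set.Ici c, ENNReal.ofReal (Real.exp (-t)) = ENNReal.ofReal (Real.exp (-c)) := by
  rw [setLIntegral_congr Ioi_ae_eq_Ici.symm, ← integral_exp_neg_Ioi c,
    ofReal_integral_eq_lintegral_ofReal (integrableOn_exp_neg_Ioi c)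
      (ae_of_all _ fun t => (Real.exp_pos _).le)]

/-- The integral of `exp (-h)` in terms of the volume of `{h ≤ 1}` for a homogeneous function
`h` of degree `r`. -/
lemma lintegral_exp_neg_homogeneous {h : (Fin (n + 1) → ℝ) → ℝ} (hc : Continuous h) {r : ℝ}
    (hr : 0 < r) (h0 : ∀ x, 0 ≤ h x) (hom : ∀ t : ℝ, 0 < t → ∀ x, h (t • x) = t ^ r * h x) :
    ∫⁻ x, ENNReal.ofReal (Real.exp (-h x)) =
      ENNReal.ofReal (Real.Gamma (1 + (n + 1) * r⁻¹)) * volume {x | h x ≤ 1} := by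
  set V := volume {x | h x ≤ 1} with hV
  have hscale : ∀ t : ℝ, 0 < t →
      volume {x | h x ≤ t} = ENNReal.ofReal (t ^ ((n + 1) * r⁻¹)) * V := by
    intro t ht
    set u := t ^ r⁻¹ with hu
    have hu0 : 0 < u := Real.rpow_pos_of_pos ht _
    have hur : u ^ r = t := by rw [hu, ← Real.rpow_mul ht.le, inv_mul_cancel₀ hr.ne', Real.rpow_one]
    have : {x | h x ≤ t} = (fun x => u⁻¹ • x) ⁻¹' {x | h x ≤ 1} := by
      ext x
      change h x ≤ t ↔ h (u⁻¹ • x) ≤ 1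
      rw [hom _ (inv_pos.2 hu0), Real.inv_rpow hu0.le, hur, inv_mul_le_iff₀ ht, mul_one]
    rw [this, Measure.addHaar_preimage_smul _ (inv_ne_zero hu0.ne')]
    have he : t ^ (((n : ℝ) + 1) * r⁻¹) = u ^ (n + 1) := by
      rw [hu, ← Real.rpow_natCast, ← Real.rpow_mul ht.le]
      push_cast
      ring_nf
    rw [he]
    simp [abs_of_pos hu0, hV]
  have hmeas : MeasurableSet {z : (Fin (n + 1) → ℝ) × ℝ | h z.1 ≤ z.2} :=
    (isClosed_le (hc.comp continuous_fst) continuous_snd).measurableSet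
  -- Write `exp (-h x)` as the integral of `exp (-t)` over `t ≥ h x` and exchange the integrals; the
  -- volume of `{h ≤ t}` scales as a power of `t`, leaving a Gamma integral.
  calc ∫⁻ x, ENNReal.ofReal (Real.exp (-h x))
      = ∫⁻ x, ∫⁻ t in Set.Ici (0 : ℝ), {z : (Fin (n + 1) → ℝ) × ℝ | h z.1 ≤ z.2}.indicator
          (fun z => ENNReal.ofReal (Real.exp (-z.2))) (x, t) := by
        refine lintegral_congr fun x => ?_
        rw [← lintegral_Ici_exp_neg, ← lintegral_indicator measurableSet_Ici,
          ← lintegral_indicator measurableSet_Ici]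
        refine lintegral_congr fun t => ?_
        by_cases ht : h x ≤ t
        · have : 0 ≤ t := (h0 x).trans ht
          simp [Set.indicator, ht, this]
        · simp [Set.indicator, ht]
    _ = ∫⁻ t in Set.Ici (0 : ℝ), ∫⁻ x, {z : (Fin (n + 1) → ℝ) × ℝ | h z.1 ≤ z.2}.indicator
          (fun z => ENNReal.ofReal (Real.exp (-z.2))) (x, t) := by
        refine lintegral_lintegral_swap ?_
        exact ((Measurable.indicator (by fun_prop) hmeas).aemeasurable)
    _ = ∫⁻ t in Set.Ioi (0 : ℝ), ENNReal.ofReal (Real.exp (-t) * t ^ ((n + 1) * r⁻¹)) * V := by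
        rw [setLIntegral_congr Ioi_ae_eq_Ici.symm]
        refine setLIntegral_congr_fun measurableSet_Ioi fun t ht => ?_
        have : ∀ x, {z : (Fin (n + 1) → ℝ) × ℝ | h z.1 ≤ z.2}.indicator
            (fun z => ENNReal.ofReal (Real.exp (-z.2))) (x, t) =
            {x | h x ≤ t}.indicator (fun _ => ENNReal.ofReal (Real.exp (-t))) x := fun x => rfl
        simp_rw [this]
        rw [lintegral_indicator_const (isClosed_le hc continuous_const).measurableSet,
          hscale t ht, ENNReal.ofReal_mul (Real.exp_pos _).le, mul_assoc]
    _ = ENNReal.ofReal (Real.Gamma (1 + (n + 1) * r⁻¹)) * V := by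
        rw [lintegral_mul_const _ (by fun_prop)]
        have hs : 0 < 1 + ((n : ℝ) + 1) * r⁻¹ := by positivity
        have hconv := Real.GammaIntegral_convergent hs
        rw [add_sub_cancel_left] at hconv
        rw [Real.Gamma_eq_integral hs, add_sub_cancel_left,
          ofReal_integral_eq_lintegral_ofReal hconv]
        filter_upwards [ae_restrict_mem measurableSet_Ioi] with t ht
        have : (0 : ℝ) < t := ht
        simp only [Pi.zero_apply]
        positivity

lemma integral_exp_neg_abs_mul_rpow {c r : ℝ} (hc : 0 < c) (hr : 0 < r) :
    ∫ x : ℝ, Real.exp (-|c * x| ^ r) = 2 * (c⁻¹ * Real.Gamma (1 + r⁻¹)) := by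
  have h : ∀ x : ℝ, Real.exp (-|c * x| ^ r) =
      (fun t : ℝ => Real.exp (-(c ^ r) * t ^ r)) |x| := by
    intro x
    simp only
    rw [abs_mul, abs_of_pos hc, Real.mul_rpow hc.le (abs_nonneg x), neg_mul]
  simp_rw [h]
  rw [integral_comp_abs (f := fun t : ℝ => Real.exp (-(c ^ r) * t ^ r)),
    integral_exp_neg_mul_rpow hr (by positivity), ← Real.rpow_mul hc.le,
    mul_div_cancel₀ _ hr.ne', Real.rpow_neg_one, one_div, add_comm (r⁻¹)]

/-- For `p = ∞` the ball is a box. Otherwise the integral of `exp (-f)` is both a product of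
one-dimensional Gamma integrals and, by homogeneity of `f`, a Gamma value times the volume. -/
theorem volume_unitBall (hp : 0 < p) (hw : ∀ i, 0 < w i) :
    (volume (unitBall p w)).toReal =
      2 ^ (n + 1) * Real.Gamma (1 + p⁻¹.toReal) ^ (n + 1) /
        ((∏ i, w i) * Real.Gamma (1 + (n + 1) * p⁻¹.toReal)) := by
  by_cases h : p = ∞
  · subst h
    have hball : unitBall ∞ w = Set.Icc (fun i => -(w i)⁻¹) (fun i => (w i)⁻¹) := by
      ext a
      have : a ∈ unitBall ∞ w ↔ ∀ i, |a i| ≤ (w i)⁻¹ := by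
        constructor
        · intro ha i
          rw [← mul_one (w i)⁻¹, le_inv_mul_iff₀ (hw i)]
          exact (mul_abs_le_lpw hp hw a i).trans ha
        · intro ha
          change lpw ∞ w a ≤ 1
          rw [lpw_top]
          refine ciSup_le fun i => ?_
          have := ha i
          rwa [← mul_one (w i)⁻¹, le_inv_mul_iff₀ (hw i)] at this
      rw [this]
      simp_rw [abs_le]
      exact forall_and
    rw [hball, Real.volume_Icc_pi_toReal fun i => by
      have := inv_pos.2 (hw i)
      linarith]
    have : ∀ i, (w i)⁻¹ - -(w i)⁻¹ = 2 * (w i)⁻¹ := fun i => by ring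
    simp_rw [this]
    rw [Finset.prod_mul_distrib, Finset.prod_inv_distrib]
    simp [div_eq_mul_inv]
  · have hr : 0 < p.toReal := ENNReal.toReal_pos hp.ne' h
    rw [ENNReal.toReal_inv]
    set r := p.toReal with hrdef
    set f : (Fin (n + 1) → ℝ) → ℝ := fun x => ∑ i, |w i * x i| ^ r with hf
    have hf0 : ∀ x, 0 ≤ f x := fun x => Finset.sum_nonneg fun i _ => by positivity
    have hfc : Continuous f := continuous_finsetSum _ fun i _ =>
      Continuous.rpow_const (by fun_prop) fun _ => Or.inr hr.le
    have hball : unitBall p w = {x | f x ≤ 1} := by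
      ext x
      change lpw p w x ≤ 1 ↔ f x ≤ 1
      rw [lpw_of_ne_top h, ← Real.rpow_le_rpow_iff (hf0 x) zero_le_one
        (by positivity : 0 < 1 / r), Real.one_rpow]
    have hhom : ∀ t : ℝ, 0 < t → ∀ x, f (t • x) = t ^ r * f x := by
      intro t ht x
      simp only [hf]
      rw [Finset.mul_sum]
      refine Finset.sum_congr rfl fun i _ => ?_
      rw [Pi.smul_apply, smul_eq_mul, mul_left_comm, abs_mul, abs_of_pos ht,
        Real.mul_rpow ht.le (abs_nonneg _)]
    have hint : ∫ x, Real.exp (-f x) =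
        2 ^ (n + 1) * Real.Gamma (1 + r⁻¹) ^ (n + 1) / ∏ i, w i := by
      have : ∀ x, Real.exp (-f x) = ∏ i, Real.exp (-|w i * x i| ^ r) := fun x => by
        rw [hf, ← Finset.sum_neg_distrib, Real.exp_sum]
      simp_rw [this]
      rw [integral_fintype_prod_volume_eq_prod (fun i (t : ℝ) => Real.exp (-|w i * t| ^ r))]
      simp_rw [integral_exp_neg_abs_mul_rpow (hw _) hr]
      rw [Finset.prod_mul_distrib, Finset.prod_mul_distrib, Finset.prod_inv_distrib]
      simp
      ring
    have hG1 : 0 < Real.Gamma (1 + r⁻¹) := Real.Gamma_pos_of_pos (by positivity)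
    have hG2 : 0 < Real.Gamma (1 + (n + 1) * r⁻¹) := Real.Gamma_pos_of_pos (by positivity)
    have hwp : 0 < ∏ i, w i := Finset.prod_pos fun i _ => hw i
    -- A non-integrable function has integral 0 by convention, so the positive value in `hint`
    -- forces integrability.
    have hintegrable : Integrable fun x => Real.exp (-f x) := by
      refine not_imp_comm.1 integral_undef ?_
      rw [hint]
      positivity
    have hkey := lintegral_exp_neg_homogeneous hfc hr hf0 hhom
    rw [← ofReal_integral_eq_lintegral_ofReal hintegrable
      (ae_of_all _ fun x => (Real.exp_pos _).le), hint] at hkey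
    have hkey' := congrArg ENNReal.toReal hkey
    rw [ENNReal.toReal_ofReal (by positivity), ENNReal.toReal_mul,
      ENNReal.toReal_ofReal hG2.le] at hkey'
    rw [hball, mul_comm (∏ i, w i), ← div_div, div_right_comm, hkey']
    field_simp

end Ball

/-! ### Level sets of the fibre count and the root measure. -/

section Density

open scoped Pointwise

variable {k l m n : ℕ}

/-- The number of factorizations of the polynomial with coefficient vector `a` whose first factor
is `factorPoly v` with `v ∈ B`. -/
def fiberCount (m : ℕ) (B : Set ((Fin k → ℝ) × (Fin l → ℂ))) (a : Fin (n + 1) → ℝ) : ℕ∞ :=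
  ((Prod.fst ⁻¹' B : Set (_ × (Fin (m + 1) → ℝ))) ∩ coeffMap n ⁻¹' {a}).encard

/-- A linear parametrization of the domain of `coeffMap`. -/
def paramEquiv (hn : k + 2 * l + m = n) :
    (Fin (n + 1) → ℝ) ≃L[ℝ] ((Fin k → ℝ) × (Fin l → ℂ)) × (Fin (m + 1) → ℝ) :=
  ContinuousLinearEquiv.ofFinrankEq (by
    simp [Module.finrank_prod, Module.finrank_pi_fintype, Complex.finrank_real_complex]
    omega)

/-- The map `coeffMap` between spaces of equal dimension, as a self-map. -/
def coeffSelfMap (hn : k + 2 * l + m = n) : (Fin (n + 1) → ℝ) → (Fin (n + 1) → ℝ) :=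
  coeffMap n ∘ paramEquiv hn

lemma contDiff_coeffSelfMap (hn : k + 2 * l + m = n) : ContDiff ℝ 1 (coeffSelfMap hn) :=
  contDiff_coeffMap.comp (paramEquiv hn).contDiff

/-- The set of parameters whose factor is indexed by `B`. -/
def paramSet (hn : k + 2 * l + m = n) (B : Set ((Fin k → ℝ) × (Fin l → ℂ))) :
    Set (Fin (n + 1) → ℝ) := (fun a => (paramEquiv hn a).1) ⁻¹' B

lemma encard_paramSet_inter (hn : k + 2 * l + m = n) (B : Set ((Fin k → ℝ) × (Fin l → ℂ)))
    (a : Fin (n + 1) → ℝ) :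
    (paramSet hn B ∩ coeffSelfMap hn ⁻¹' {a}).encard = fiberCount m B a := by
  rw [fiberCount, ← (paramEquiv hn).injective.encard_image]
  congr 1
  ext y
  constructor
  · rintro ⟨x, hx, rfl⟩
    exact hx
  · intro hy
    refine ⟨(paramEquiv hn).symm y, ?_, (paramEquiv hn).apply_symm_apply y⟩
    simpa [paramSet, coeffSelfMap] using hy

/-- `paramEquiv` is an arbitrary linear isomorphism and need not preserve volume; only null sets
matter below. -/
lemma quasiMeasurePreserving_param (hn : k + 2 * l + m = n) :
    Measure.QuasiMeasurePreserving (fun a => (paramEquiv hn a).1) volume volume := by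
  have h1 : Measure.QuasiMeasurePreserving (paramEquiv hn) volume volume := by
    refine ⟨(paramEquiv hn).continuous.measurable, ?_⟩
    have : (volume.map (paramEquiv hn)).IsAddHaarMeasure :=
      (paramEquiv hn).isAddHaarMeasure_map volume
    have h1 : (volume : Measure ((Fin k → ℝ) × (Fin l → ℂ))).IsAddHaarMeasure :=
      Measure.prod.instIsAddHaarMeasure volume volume
    have h2 : (volume : Measure
        (((Fin k → ℝ) × (Fin l → ℂ)) × (Fin (m + 1) → ℝ))).IsAddHaarMeasure :=
      Measure.prod.instIsAddHaarMeasure volume volume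
    exact Measure.absolutelyContinuous_isAddHaarMeasure _ _
  exact Measure.quasiMeasurePreserving_fst.comp h1

lemma volume_frontier_paramSet (hn : k + 2 * l + m = n)
    {B : Set ((Fin k → ℝ) × (Fin l → ℂ))} (hB : volume (frontier B) = 0) :
    volume (frontier (paramSet hn B)) = 0 := by
  have hop : IsOpenMap fun a => (paramEquiv hn a).1 :=
    isOpenMap_fst.comp (paramEquiv hn).toHomeomorph.isOpenMap
  have hcont : Continuous fun a => (paramEquiv hn a).1 :=
    continuous_fst.comp (paramEquiv hn).continuous
  rw [paramSet, ← hop.preimage_frontier_eq_frontier_preimage hcont]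
  exact (quasiMeasurePreserving_param hn).preimage_null hB

lemma volume_setOf_last_eq_zero : volume {a : Fin (n + 1) → ℝ | a (Fin.last n) = 0} = 0 := by
  have := Measure.addHaar_submodule volume (LinearMap.ker (LinearMap.proj (Fin.last n) :
    (Fin (n + 1) → ℝ) →ₗ[ℝ] ℝ)) (by
      intro h
      have : (Pi.single (Fin.last n) (1 : ℝ) : Fin (n + 1) → ℝ) ∈
          LinearMap.ker (LinearMap.proj (Fin.last n) : (Fin (n + 1) → ℝ) →ₗ[ℝ] ℝ) := by
        rw [h]
        trivial
      simp at this)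
  exact this

/-- For almost every polynomial of degree `n`, the count of factorizations is locally constant. -/
lemma ae_eventually_fiberCount_eq (hn : k + 2 * l + m = n)
    {B : Set ((Fin k → ℝ) × (Fin l → ℂ))} (hB : volume (frontier B) = 0) :
    ∀ᵐ a : Fin (n + 1) → ℝ, a (Fin.last n) ≠ 0 ∧
      ∀ᶠ b in 𝓝 a, fiberCount m B b = fiberCount m B a := by
  set f := coeffSelfMap hn with hf
  have hfc := contDiff_coeffSelfMap hn
  have hd : ∀ s : Set (Fin (n + 1) → ℝ), ∀ x ∈ s,
      HasFDerivWithinAt f (fderiv ℝ f x) s x := fun s x _ =>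
    ((hfc.differentiable (by simp)) x).hasFDerivAt.hasFDerivWithinAt
  have hsard : volume (f '' {x | (fderiv ℝ f x).det = 0}) = 0 :=
    addHaar_image_eq_zero_of_det_fderivWithin_eq_zero volume (hd _) fun x hx => hx
  have hfr : volume (f '' frontier (paramSet hn B)) = 0 :=
    addHaar_image_eq_zero_of_differentiableOn_of_addHaar_eq_zero volume
      (hfc.differentiable (by simp)).differentiableOn (volume_frontier_paramSet hn hB)
  -- Excluded are critical values, images of boundary points, and polynomials of lower degree, near
  -- which properness is not available.
  filter_upwards [measure_eq_zero_iff_ae_notMem.1 hsard, measure_eq_zero_iff_ae_notMem.1 hfr,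
    measure_eq_zero_iff_ae_notMem.1 (volume_setOf_last_eq_zero (n := n))] with a h1 h2 h3
  have h3' : a (Fin.last n) ≠ 0 := h3
  refine ⟨h3', ?_⟩
  simp_rw [← encard_paramSet_inter hn]
  have hδ : 0 < |a (Fin.last n)| / 2 := by positivity
  refine eventually_encard_fiber_eq hfc
    (K := {b | ‖b‖ ≤ ‖a‖ + 1 ∧ |a (Fin.last n)| / 2 ≤ |b (Fin.last n)|}) ?_ ?_
    (fun x hx h0 => h1 ⟨x, h0, hx⟩) (fun x hx h0 => h2 ⟨x, h0, hx⟩)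
  · refine Filter.inter_mem ?_ ?_
    · exact (continuous_norm.tendsto a).eventually_le_const (by linarith)
    · have : Continuous fun b : Fin (n + 1) → ℝ => |b (Fin.last n)| :=
        (continuous_apply _).abs
      exact (this.tendsto a).eventually_const_le (by linarith)
  · exact (paramEquiv hn).toHomeomorph.isCompact_preimage.2 (isCompact_preimage_coeffMap hn hδ)

variable {p : ℝ≥0∞} {w : Fin (n + 1) → ℝ}

/-- Coefficient vectors in the unit ball of polynomials of degree `n` with at least `j`
factorizations indexed by `B`. -/
def levelSet (m : ℕ) (p : ℝ≥0∞) (w : Fin (n + 1) → ℝ) (B : Set ((Fin k → ℝ) × (Fin l → ℂ)))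
    (j : ℕ) : Set (Fin (n + 1) → ℝ) :=
  {a | a ∈ unitBall p w ∧ a (Fin.last n) ≠ 0 ∧ (j : ℕ∞) ≤ fiberCount m B a}

/-- At almost every point all three defining conditions are locally constant, and such a point is
not on the frontier. -/
lemma volume_frontier_levelSet (hp : 0 < p) (hw : ∀ i, 0 < w i) (hn : k + 2 * l + m = n)
    {B : Set ((Fin k → ℝ) × (Fin l → ℂ))} (hB : volume (frontier B) = 0) (j : ℕ) :
    volume (frontier (levelSet m p w B j)) = 0 := by
  rw [measure_eq_zero_iff_ae_notMem]
  filter_upwards [ae_eventually_fiberCount_eq hn hB,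
    measure_eq_zero_iff_ae_notMem.1 (volume_frontier_unitBall hp hw)] with a h1 h2 hfr
  have hlast : ∀ᶠ b : Fin (n + 1) → ℝ in 𝓝 a, b (Fin.last n) ≠ 0 :=
    (continuous_apply (Fin.last n)).continuousAt.eventually_ne h1.1
  have hball : ∀ᶠ b in 𝓝 a, (b ∈ unitBall p w ↔ a ∈ unitBall p w) := by
    by_cases hc : a ∈ closure (unitBall p w)
    · have hi : a ∈ interior (unitBall p w) := by
        by_contra h
        exact h2 ⟨hc, h⟩
      filter_upwards [isOpen_interior.mem_nhds hi] with b hb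
      exact iff_of_true (interior_subset hb) (interior_subset hi)
    · filter_upwards [isClosed_closure.isOpen_compl.mem_nhds hc] with b hb
      exact iff_of_false (fun h => hb (subset_closure h)) fun h => hc (subset_closure h)
  have hS : ∀ᶠ b in 𝓝 a, (b ∈ levelSet m p w B j ↔ a ∈ levelSet m p w B j) := by
    filter_upwards [hlast, hball, h1.2] with b hb1 hb2 hb3
    simp only [levelSet, Set.mem_ofPred_eq, hb2, hb3, iff_true_intro hb1, iff_true_intro h1.1]
  by_cases ha : a ∈ levelSet m p w B j
  · exact hfr.2 (mem_interior_iff_mem_nhds.2 (hS.mono fun b hb => hb.2 ha))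
  · obtain ⟨b, hb, hb'⟩ := (mem_closure_iff_frequently.1 hfr.1).and_eventually hS |>.exists
    exact ha (hb'.1 hb)

lemma levelSet_subset (B : Set ((Fin k → ℝ) × (Fin l → ℂ))) (j : ℕ) :
    levelSet m p w B j ⊆ unitBall p w := fun _ h => h.1

/-- Allowing negative `t` yields the symmetry of the level sets together with their star shape. -/
lemma smul_mem_levelSet (hp : 0 < p) {B : Set ((Fin k → ℝ) × (Fin l → ℂ))} {j : ℕ} {t : ℝ}
    (ht : t ≠ 0) (ht1 : |t| ≤ 1) {a : Fin (n + 1) → ℝ} (ha : a ∈ levelSet m p w B j) :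
    t • a ∈ levelSet m p w B j := by
  refine ⟨?_, ?_, ?_⟩
  · have h1 : lpw p w a ≤ 1 := ha.1
    change lpw p w (t • a) ≤ 1
    rw [lpw_smul hp]
    nlinarith [abs_pos.2 ht]
  · rw [Pi.smul_apply, smul_eq_mul]
    exact mul_ne_zero ht ha.2.1
  · rw [fiberCount, encard_coeffMap_fiber_smul B a ht]
    exact ha.2.2

/-- The intensity measure of the root tuples of random polynomials with coefficients in the unit
ball. -/
def rootMeasure (hn : k + 2 * l + m = n) (p : ℝ≥0∞) (w : Fin (n + 1) → ℝ) :
    Measure ((Fin k → ℝ) × (Fin l → ℂ)) :=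
  ((volume.restrict (coeffSelfMap hn ⁻¹' unitBall p w)).withDensity fun x =>
    ENNReal.ofReal |(fderiv ℝ (coeffSelfMap hn) x).det|).map fun a => (paramEquiv hn a).1

lemma rootMeasure_apply (hp : 0 < p) (hn : k + 2 * l + m = n)
    {B : Set ((Fin k → ℝ) × (Fin l → ℂ))} (hB : MeasurableSet B) :
    rootMeasure hn p w B = ∫⁻ a in unitBall p w, (fiberCount m B a : ℝ≥0∞) := by
  have hm := (quasiMeasurePreserving_param hn).measurable
  rw [rootMeasure, Measure.map_apply hm hB, withDensity_apply _ (hm hB),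
    Measure.restrict_restrict (hm hB)]
  simp_rw [← encard_paramSet_inter hn]
  exact (lintegral_encard_fiber volume (contDiff_coeffSelfMap hn) (hm hB)
    (isClosed_unitBall hp).measurableSet).symm

/-- This is what provides the density `ρ`, by Radon–Nikodym. -/
lemma rootMeasure_absolutelyContinuous (hn : k + 2 * l + m = n) :
    rootMeasure hn p w ≪ volume := by
  have h : (volume.restrict (coeffSelfMap hn ⁻¹' unitBall p w)).withDensity
      (fun x => ENNReal.ofReal |(fderiv ℝ (coeffSelfMap hn) x).det|) ≪ volume :=
    (withDensity_absolutelyContinuous _ _).trans Measure.absolutelyContinuous_restrict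
  exact (h.map (quasiMeasurePreserving_param hn).measurable).trans
    (quasiMeasurePreserving_param hn).absolutelyContinuous

lemma fiberCount_le (hn : k + 2 * l + m = n) {a : Fin (n + 1) → ℝ} (ha : a (Fin.last n) ≠ 0)
    (B : Set ((Fin k → ℝ) × (Fin l → ℂ))) :
    fiberCount m B a ≤ ((n ^ k * n ^ l : ℕ) : ℕ∞) :=
  encard_coeffMap_fiber_le hn ha _

lemma isFiniteMeasure_rootMeasure (hp : 0 < p) (hw : ∀ i, 0 < w i) (hn : k + 2 * l + m = n) :
    IsFiniteMeasure (rootMeasure hn p w) := by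
  refine ⟨?_⟩
  rw [rootMeasure_apply hp hn MeasurableSet.univ]
  calc ∫⁻ a in unitBall p w, (fiberCount m (Set.univ : Set ((Fin k → ℝ) × (Fin l → ℂ))) a : ℝ≥0∞)
      ≤ ∫⁻ a in unitBall p w, ((n ^ k * n ^ l : ℕ) : ℝ≥0∞) := by
        refine lintegral_mono_ae (ae_restrict_of_ae ?_)
        filter_upwards [measure_eq_zero_iff_ae_notMem.1 (volume_setOf_last_eq_zero (n := n))]
          with a ha
        exact_mod_cast (ENat.toENNReal_le.2 (fiberCount_le hn ha _))
    _ < ∞ := by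
        rw [setLIntegral_const]
        exact ENNReal.mul_lt_top (ENNReal.natCast_lt_top _)
          (isBounded_unitBall hp hw).measure_lt_top

/-- Discrete layer-cake identity: `N` is the number of levels `1, …, M` that it reaches. The index
is shifted because level 0 is always reached. -/
lemma card_filter_le_encard {N : ℕ∞} {M : ℕ} (h : N ≤ M)
    [DecidablePred fun j : ℕ => ((j + 1 : ℕ) : ℕ∞) ≤ N] :
    (((Finset.range M).filter fun j => ((j + 1 : ℕ) : ℕ∞) ≤ N).card : ℕ∞) = N := by
  lift N to ℕ using ne_top_of_le_ne_top (ENat.natCast_ne_top M) h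
  have hNM : N ≤ M := by exact_mod_cast h
  have : (Finset.range M).filter (fun j => ((j + 1 : ℕ) : ℕ∞) ≤ N) = Finset.range N := by
    ext j
    simp only [Finset.mem_filter, Finset.mem_range, Nat.cast_le]
    omega
  rw [this, Finset.card_range]

lemma rootMeasure_eq_sum (hp : 0 < p) (hw : ∀ i, 0 < w i) (hn : k + 2 * l + m = n)
    {B : Set ((Fin k → ℝ) × (Fin l → ℂ))} (hB : MeasurableSet B)
    (hfr : volume (frontier B) = 0) :
    rootMeasure hn p w B =
      ∑ j ∈ Finset.range (n ^ k * n ^ l), volume (levelSet m p w B (j + 1)) := by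
  classical
  have hnull : ∀ j, NullMeasurableSet (levelSet m p w B j) := fun j =>
    nullMeasurableSet_of_null_frontier (volume_frontier_levelSet hp hw hn hfr j)
  have hball : MeasurableSet (unitBall p w) := (isClosed_unitBall hp).measurableSet
  rw [rootMeasure_apply hp hn hB, ← lintegral_indicator hball]
  have hae : ∀ᵐ a : Fin (n + 1) → ℝ, (unitBall p w).indicator
      (fun a => (fiberCount m B a : ℝ≥0∞)) a =
      ∑ j ∈ Finset.range (n ^ k * n ^ l),
        (levelSet m p w B (j + 1)).indicator (1 : (Fin (n + 1) → ℝ) → ℝ≥0∞) a := by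
    filter_upwards [measure_eq_zero_iff_ae_notMem.1 (volume_setOf_last_eq_zero (n := n))]
      with a ha
    have ha' : a (Fin.last n) ≠ 0 := ha
    by_cases hab : a ∈ unitBall p w
    · rw [Set.indicator_of_mem hab, ← card_filter_le_encard (fiberCount_le hn ha' B)]
      simp [Set.indicator, levelSet, hab, ha']
    · simp [Set.indicator, levelSet, hab]
  rw [lintegral_congr_ae hae, lintegral_finsetSum']
  · exact Finset.sum_congr rfl fun j _ => lintegral_indicator_one₀ (hnull _)
  · exact fun j _ => aemeasurable_one.indicator₀ (hnull _)

end Density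

/-! ### From root tuples to prime polynomials in level sets. -/

section Counting

open scoped Pointwise

variable {k l m n : ℕ} {p : ℝ≥0∞} {w : Fin (n + 1) → ℝ}

/-- The tuples of distinct roots of `q` in `B`. -/
def rootTuples (B : Set ((Fin k → ℝ) × (Fin l → ℂ))) (q : ℤ[X]) :
    Set ((Fin k → ℝ) × (Fin l → ℂ)) :=
  {v | v ∈ B ∧ Function.Injective v.1 ∧ Function.Injective v.2 ∧
    (∀ i, Polynomial.aeval (v.1 i) q = 0) ∧ (∀ j, Polynomial.aeval (v.2 j) q = 0)}

lemma encard_rootTuples (hn : k + 2 * l + m = n) {B : Set ((Fin k → ℝ) × (Fin l → ℂ))}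
    (hB : B ⊆ configSpace k l) {q : ℤ[X]} (hq : IsPrimePoly q) (hqn : q.natDegree = n) :
    (rootTuples B q).encard = fiberCount m B (coeffVec (n + 1) (q.map (Int.castRingHom ℝ))) := by
  rw [rootTuples, ← image_fst_coeffMap_fiber hn hB hq hqn, Set.InjOn.encard_image]
  · rfl
  · exact (injOn_fst_coeffMap_fiber hn _).mono Set.inter_subset_right

/-- Over `ℚ`, `q` is up to a constant the minimal polynomial of `z`; primitivity and Gauss's lemma
bring the divisibility back to `ℤ`. -/
lemma IsPrimePoly.dvd_of_common_root {q q' : ℤ[X]} (hq : IsPrimePoly q) {z : ℂ}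
    (h : Polynomial.aeval z q = 0) (h' : Polynomial.aeval z q' = 0) : q ∣ q' := by
  rw [Polynomial.IsPrimitive.Int.dvd_iff_map_cast_dvd_map_cast q q' hq.2.1]
  have hz : Polynomial.aeval z (q.map (Int.castRingHom ℚ)) = 0 := by
    rw [← h]
    exact Polynomial.aeval_map_algebraMap ℚ z q
  have hz' : Polynomial.aeval z (q'.map (Int.castRingHom ℚ)) = 0 := by
    rw [← h']
    exact Polynomial.aeval_map_algebraMap ℚ z q'
  exact (dvd_mul_right _ _).trans
    ((minpoly.eq_of_irreducible hq.1 hz).symm ▸ minpoly.dvd ℚ z hz')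

/-- Mutual divisibility leaves a unit `±1`, and positive leading coefficients exclude `-1`. -/
lemma IsPrimePoly.eq_of_common_root {q q' : ℤ[X]} (hq : IsPrimePoly q) (hq' : IsPrimePoly q')
    {z : ℂ} (h : Polynomial.aeval z q = 0) (h' : Polynomial.aeval z q' = 0) : q = q' := by
  have hass := associated_of_dvd_dvd (hq.dvd_of_common_root h h') (hq'.dvd_of_common_root h' h)
  obtain ⟨u, hu⟩ := hass
  obtain ⟨c, hc, hcu⟩ := Polynomial.isUnit_iff.1 u.isUnit
  rw [← hcu] at hu
  have h1 := congrArg Polynomial.leadingCoeff hu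
  rw [Polynomial.leadingCoeff_mul, Polynomial.leadingCoeff_C] at h1
  rcases Int.isUnit_iff.1 hc with rfl | rfl
  · simpa using hu
  · have := hq.2.2
    have := hq'.2.2
    linarith

/-- Since `0 < k + 2 * l` there is at least one coordinate, and it determines its prime polynomial.
-/
lemma rootTuples_disjoint (hkl : 0 < k + 2 * l) {B : Set ((Fin k → ℝ) × (Fin l → ℂ))}
    {q q' : ℤ[X]} (hq : IsPrimePoly q) (hq' : IsPrimePoly q') (hne : q ≠ q') :
    Disjoint (rootTuples B q) (rootTuples B q') := by
  rw [Set.disjoint_left]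
  intro v hv hv'
  apply hne
  rcases Nat.eq_zero_or_pos k with hk | hk
  · have hl : 0 < l := by omega
    exact hq.eq_of_common_root hq' (hv.2.2.2.2 ⟨0, hl⟩) (hv'.2.2.2.2 ⟨0, hl⟩)
  · have hR : ∀ (x : ℝ) (q : ℤ[X]), Polynomial.aeval x q = 0 →
        Polynomial.aeval (algebraMap ℝ ℂ x) q = 0 := by
      intro x q hx
      rw [Polynomial.aeval_algebraMap_apply, hx, map_zero]
    exact hq.eq_of_common_root hq' (hR _ _ (hv.2.2.2.1 ⟨0, hk⟩)) (hR _ _ (hv'.2.2.2.1 ⟨0, hk⟩))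

lemma conjTuples_eq (p : ℝ≥0∞) (w : Fin (n + 1) → ℝ) (Q : ℝ)
    (B : Set ((Fin k → ℝ) × (Fin l → ℂ))) :
    conjTuples p w k l Q B = ⋃ q ∈ primePolys p w Q, rootTuples B q := by
  ext v
  simp only [conjTuples, rootTuples, Set.mem_iUnion, Set.mem_ofPred_eq, exists_prop]
  constructor
  · rintro ⟨h1, h2, h3, q, hq, h4, h5⟩
    exact ⟨q, hq, h1, h2, h3, h4, h5⟩
  · rintro ⟨q, hq, h1, h2, h3, h4, h5⟩
    exact ⟨h1, h2, h3, q, hq, h4, h5⟩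

lemma mem_primePolys_iff (hp : 0 < p) {Q : ℝ} (hQ : 0 < Q) {q : ℤ[X]} :
    q ∈ primePolys p w Q ↔ q.natDegree = n ∧ IsPrimePoly q ∧
      coeffVec (n + 1) q ∈ latticePoints (unitBall p w) Q := by
  have : polyHeight p w q ≤ Q ↔ coeffVec (n + 1) q ∈ latticePoints (unitBall p w) Q := by
    change lpw p w _ ≤ Q ↔ lpw p w (Q⁻¹ • _) ≤ 1
    rw [lpw_smul hp, abs_of_pos (inv_pos.2 hQ), inv_mul_le_iff₀ hQ, mul_one]
    rfl
  simp only [primePolys, Set.mem_ofPred_eq, this]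
  tauto

lemma finite_primePolys (hp : 0 < p) (hw : ∀ i, 0 < w i) (Q : ℝ) : (primePolys p w Q).Finite := by
  have hQ : 0 < max Q 1 := lt_max_of_lt_right one_pos
  refine ((finite_latticePoints (isBounded_unitBall hp hw) hQ).image vecPoly).subset ?_
  rintro q ⟨h1, h2, h3⟩
  have hq := (mem_primePolys_iff (w := w) hp hQ (q := q)).1 ⟨h1, h2.trans (le_max_left _ _), h3⟩
  exact ⟨_, hq.2.2, vecPoly_coeffVec_of_natDegree_lt (by omega)⟩

lemma map_coeffVec (d : ℕ) (q : ℤ[X]) :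
    coeffVec d (q.map (Int.castRingHom ℝ)) = fun i : Fin d => (q.coeff i : ℝ) := by
  ext i
  simp [coeffVec]

lemma coeffVec_map_last_ne_zero {q : ℤ[X]} (hq : IsPrimePoly q) (hqn : q.natDegree = n) :
    coeffVec (n + 1) (q.map (Int.castRingHom ℝ)) (Fin.last n) ≠ 0 := by
  rw [map_coeffVec]
  have : 0 < q.coeff n := by
    rw [← hqn]
    exact hq.2.2
  exact Int.cast_ne_zero.2 this.ne'

lemma encard_rootTuples_le (hn : k + 2 * l + m = n) {B : Set ((Fin k → ℝ) × (Fin l → ℂ))}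
    (hB : B ⊆ configSpace k l) {q : ℤ[X]} (hq : IsPrimePoly q) (hqn : q.natDegree = n) :
    (rootTuples B q).encard ≤ ((n ^ k * n ^ l : ℕ) : ℕ∞) := by
  rw [encard_rootTuples hn hB hq hqn]
  exact fiberCount_le hn (coeffVec_map_last_ne_zero hq hqn) B

lemma finite_conjTuples (hp : 0 < p) (hw : ∀ i, 0 < w i) (hn : k + 2 * l + m = n)
    {B : Set ((Fin k → ℝ) × (Fin l → ℂ))} (hB : B ⊆ configSpace k l) (Q : ℝ) :
    (conjTuples p w k l Q B).Finite := by
  rw [conjTuples_eq]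
  refine (finite_primePolys hp hw Q).biUnion fun q hq => ?_
  exact Set.finite_of_encard_le_coe (encard_rootTuples_le hn hB hq.2.2 hq.1)

lemma mem_levelSet_iff (hp : 0 < p) (hn : k + 2 * l + m = n)
    {B : Set ((Fin k → ℝ) × (Fin l → ℂ))} (hB : B ⊆ configSpace k l) {Q : ℝ} (hQ : 0 < Q)
    {q : ℤ[X]} (j : ℕ) :
    (q.natDegree = n ∧ IsPrimePoly q ∧ coeffVec (n + 1) q ∈ latticePoints (levelSet m p w B j) Q) ↔
      q ∈ primePolys p w Q ∧ (j : ℕ∞) ≤ (rootTuples B q).encard := by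
  rw [mem_primePolys_iff hp hQ, and_assoc, and_assoc]
  refine and_congr_right fun hqn => and_congr_right fun hq => ?_
  rw [encard_rootTuples hn hB hq hqn]
  have h0 := coeffVec_map_last_ne_zero hq hqn
  have hcount : fiberCount m B (Q⁻¹ • coeffVec (n + 1) (q.map (Int.castRingHom ℝ))) =
      fiberCount m B (coeffVec (n + 1) (q.map (Int.castRingHom ℝ))) :=
    encard_coeffMap_fiber_smul B _ (inv_ne_zero hQ.ne')
  rw [← hcount]
  rw [map_coeffVec] at h0 ⊢
  constructor
  · exact fun h => ⟨h.1, h.2.2⟩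
  · refine fun h => ⟨h.1, ?_, h.2⟩
    rw [Pi.smul_apply, smul_eq_mul]
    exact mul_ne_zero (inv_ne_zero hQ.ne') h0

/-- Each tuple belongs to a single prime polynomial, so `Phi` is the sum of the root-tuple counts
over those polynomials. Cutting each count into levels and exchanging sums gives one prime-counting
problem per level. -/
lemma Phi_eq_sum (hp : 0 < p) (hw : ∀ i, 0 < w i) (hkl : 0 < k + 2 * l)
    (hn : k + 2 * l + m = n) {B : Set ((Fin k → ℝ) × (Fin l → ℂ))} (hB : B ⊆ configSpace k l)
    {Q : ℝ} (hQ : 0 < Q) :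
    Phi p w k l Q B = ∑ j ∈ Finset.range (n ^ k * n ^ l), ({q : ℤ[X] | q.natDegree = n ∧
      IsPrimePoly q ∧
      coeffVec (n + 1) q ∈ latticePoints (levelSet m p w B (j + 1)) Q}).ncard := by
  classical
  set T := (finite_primePolys hp hw Q).toFinset with hT
  have hTm : ∀ q, q ∈ T ↔ q ∈ primePolys p w Q := fun q => Set.Finite.mem_toFinset _
  have hfin : ∀ q ∈ T, (rootTuples B q).Finite := fun q hq => by
    have hq' := (hTm q).1 hq
    exact Set.finite_of_encard_le_coe (encard_rootTuples_le hn hB hq'.2.2 hq'.1)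
  have hN : ∀ q ∈ T, (rootTuples B q).ncard =
      ((Finset.range (n ^ k * n ^ l)).filter
        fun j => ((j + 1 : ℕ) : ℕ∞) ≤ (rootTuples B q).encard).card := by
    intro q hq
    have hq' := (hTm q).1 hq
    have h := card_filter_le_encard (encard_rootTuples_le hn hB hq'.2.2 hq'.1)
    exact (congrArg ENat.toNat h).symm
  have hPhi : Phi p w k l Q B = ∑ q ∈ T, (rootTuples B q).ncard := by
    have hfin' : ∀ q ∈ primePolys p w Q, (rootTuples B q).Finite := fun q hq =>
      hfin q ((hTm q).2 hq)
    rw [Phi, conjTuples_eq, (finite_primePolys hp hw Q).ncard_biUnion hfin',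
      finsum_mem_eq_finite_toFinset_sum _ (finite_primePolys hp hw Q)]
    exact fun q hq q' hq' hne => rootTuples_disjoint hkl hq.2.2 hq'.2.2 hne
  rw [hPhi, Finset.sum_congr rfl hN]
  simp_rw [Finset.card_filter]
  rw [Finset.sum_comm]
  refine Finset.sum_congr rfl fun j _ => ?_
  rw [← Finset.card_filter, ← Set.ncard_coe_finset]
  congr 1
  ext q
  rw [Set.mem_ofPred_eq, mem_levelSet_iff hp hn hB hQ]
  simp [hTm]

end Counting

end AlgHeight

end

/-! ### Assembly of the limit. -/

theorem theorem2235 (n : ℕ) (p : ℝ≥0∞) (hp : 0 < p) (w : Fin (n + 1) → ℝ) (hw : ∀ i, 0 < w i)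
    (k l : ℕ) (hkl : 0 < k + 2 * l) (hn : k + 2 * l ≤ n) :
    -- the volume of the unit ball; here `p⁻¹.toReal` is `1 / p`, with `1 / ∞ = 0`
    (volume (AlgHeight.unitBall p w)).toReal =
      2 ^ (n + 1) * Real.Gamma (1 + p⁻¹.toReal) ^ (n + 1) /
        ((∏ i, w i) * Real.Gamma (1 + (n + 1) * p⁻¹.toReal)) ∧
    ∃ ρ : (Fin k → ℝ) × (Fin l → ℂ) → ℝ,
      (∀ v ∈ AlgHeight.configSpace k l, 0 ≤ ρ v) ∧
      IntegrableOn ρ (AlgHeight.configSpace k l) volume ∧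
      ∀ B : Set ((Fin k → ℝ) × (Fin l → ℂ)), B ⊆ AlgHeight.configSpace k l →
        MeasurableSet B → volume (frontier B) = 0 →
        (∀ Q : ℝ, (AlgHeight.conjTuples p w k l Q B).Finite) ∧
        Tendsto (fun Q : ℝ => (AlgHeight.Phi p w k l Q B : ℝ) / Q ^ (n + 1)) atTop
          (𝓝 ((volume (AlgHeight.unitBall p w)).toReal /
            (2 * (riemannZeta ((n : ℂ) + 1)).re) * ∫ v in B, ρ v)) := by
  open AlgHeight in
  refine ⟨volume_unitBall hp hw, ?_⟩
  obtain ⟨m, hm⟩ : ∃ m, k + 2 * l + m = n := ⟨n - (k + 2 * l), by omega⟩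
  set V := (volume (unitBall p w)).toReal with hV
  have hVpos : 0 < V := by
    rw [hV, volume_unitBall hp hw]
    have h1 : 0 < Real.Gamma (1 + p⁻¹.toReal) := Real.Gamma_pos_of_pos (by positivity)
    have h2 : 0 < Real.Gamma (1 + (n + 1) * p⁻¹.toReal) := Real.Gamma_pos_of_pos (by positivity)
    have h3 : 0 < ∏ i, w i := Finset.prod_pos fun i _ => hw i
    positivity
  have hfinite := isFiniteMeasure_rootMeasure hp hw hm
  set μ := rootMeasure hm p w with hμ
  -- The density of the root measure is divided by `V` because the asserted limit carries `V` as a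
  -- separate factor.
  refine ⟨fun v => (μ.rnDeriv volume v).toReal / V, fun v _ => by positivity,
    (Measure.integrable_toReal_rnDeriv.div_const V).integrableOn, fun B hB hBm hBfr =>
    ⟨finite_conjTuples hp hw hm hB, ?_⟩⟩
  have hint : ∫ v in B, (μ.rnDeriv volume v).toReal / V = μ.real B / V := by
    rw [integral_div, Measure.setIntegral_toReal_rnDeriv (rootMeasure_absolutelyContinuous hm)]
  have hsum : μ.real B =
      ∑ j ∈ Finset.range (n ^ k * n ^ l), volume.real (levelSet m p w B (j + 1)) := by
    rw [measureReal_def, hμ, rootMeasure_eq_sum hp hw hm hBm hBfr, ENNReal.toReal_sum]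
    · rfl
    · exact fun j _ => ((isBounded_unitBall hp hw).subset (levelSet_subset B _)).measure_lt_top.ne
  have hlim : V / (2 * (riemannZeta ((n : ℂ) + 1)).re) *
      ∫ v in B, (μ.rnDeriv volume v).toReal / V =
      ∑ j ∈ Finset.range (n ^ k * n ^ l), volume.real (levelSet m p w B (j + 1)) /
        (2 * (riemannZeta ((n : ℂ) + 1)).re) := by
    rw [hint, hsum, ← Finset.sum_div]
    field_simp
  rw [hlim]
  -- The number of levels `n ^ k * n ^ l` does not depend on `Q`, so the limit is taken level by
  -- level.
  have hterm := tendsto_finsetSum (Finset.range (n ^ k * n ^ l)) fun j _ =>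
    tendsto_ncard_prime (n := n) (by omega) (S := levelSet m p w B (j + 1))
      ((isBounded_unitBall hp hw).subset (levelSet_subset B _))
      (volume_frontier_levelSet hp hw hm hBfr _)
      (fun t h0 h1 => by
        rintro _ ⟨a, ha, rfl⟩
        exact smul_mem_levelSet hp h0.ne' (by rwa [abs_of_pos h0]) ha)
      (fun s hs => by
        rw [← neg_one_smul ℝ s]
        exact smul_mem_levelSet hp (by norm_num) (by norm_num) hs)
      (fun s hs => hs.2.1)
  refine hterm.congr' ?_
  filter_upwards [eventually_gt_atTop 0] with Q hQ
  rw [Phi_eq_sum hp hw hkl hm hB hQ]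
  push_cast
  rw [Finset.sum_div]
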